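/- Call a C*-algebra $B$ an AF algebra if there is an increasing sequence $B_0 \subseteq B_1 \subseteq \cdots$ of finite dimensional C*-subalgebras of $B$ whose union is dense in $B$. Let $A$ be a unital C*-algebra and let $\alpha \colon G \to \mathrm{Aut}(A)$ be an action of a finite group $G$ on $A$ by *-automorphisms. We say that $\alpha$ has the strict Rokhlin property if for every finite set $F \subseteq A$ and every $\varepsilon > 0$ there are mutually orthogonal projections $e_g \in A$ for $g \in G$ such that: (1) $\| \alpha_g (e_h) - e_{g h} \| < \varepsilon$ for all $g, h \in G$; (2) $\| e_g a - a e_g \| < \varepsilon$ for all $g \in G$ and all $a \in F$; (3) $\sum_{g \in G} e_g = 1$. Theorem. Let $A$ be a unital AF algebra, and let $\alpha \colon G \to \mathrm{Aut}(A)$ be an action of a finite group $G$ on $A$ which has the strict Rokhlin property. Then the crossed product C*-algebra $C^*(G, A, \alpha)$ is an AF algebra. -/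

import Mathlib

set_option linter.unusedSectionVars false

universe u v

/-- A C⋆-algebra is *AF* (approximately finite dimensional) if it is the closure of the union of
an increasing sequence of finite dimensional C⋆-subalgebras. The subalgebras are not required to
contain the unit of `A`, if there is one. -/
def IsAFAlgebra (A : Type u) [NonUnitalCStarAlgebra A] : Prop :=
  ∃ F : ℕ → NonUnitalStarSubalgebra ℂ A,
    Monotone F ∧ (∀ n, FiniteDimensional ℂ (F n)) ∧ Dense (⋃ n, (F n : Set A))

/-- The strict Rokhlin property of an action `α : G → Aut(A)` of a finite group on a unital
C⋆-algebra. -/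
def HasStrictRokhlinProperty {A : Type u} [CStarAlgebra A] {G : Type v} [Group G] [Fintype G]
    (α : G →* (A ≃⋆ₐ[ℂ] A)) : Prop :=
  ∀ (F : Finset A) (ε : ℝ), 0 < ε → ∃ e : G → A,
    (∀ g, IsStarProjection (e g)) ∧
    (∀ g h, g ≠ h → e g * e h = 0) ∧
    (∀ g h, ‖α g (e h) - e (g * h)‖ < ε) ∧
    (∀ g, ∀ a ∈ F, ‖e g * a - a * e g‖ < ε) ∧
    ∑ g, e g = 1

/-- The crossed product `C⋆(G, A, α)` of a unital C⋆-algebra `A` by an action `α` of a finite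
group `G`. Its elements are the functions `f : G → A`; the function `f` stands for the sum
`∑ g, f g * u g`, where `u g` is the canonical unitary that implements `α g`. The twisted
convolution algebra of these functions is given the universal C⋆-norm, that is, the supremum of
the seminorms that come from all covariant homomorphisms of `(G, A, α)` to unital C⋆-algebras (see
`CrossedProduct.CovariantHom` and the `Norm` instance). Since `G` is finite, it is already
complete in this norm, which is proved below. -/
@[ext]
structure CrossedProduct {A : Type u} [CStarAlgebra A] {G : Type v} [Group G] [Fintype G]
    (α : G →* (A ≃⋆ₐ[ℂ] A)) : Type (max u v) where
  /-- The function `G → A` underlying an element of the crossed product. -/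
  coeff : G → A

namespace CrossedProduct

noncomputable section

variable {A : Type u} [CStarAlgebra A] {G : Type v} [Group G] [Fintype G]
  {α : G →* (A ≃⋆ₐ[ℂ] A)}

/-- Elements of the crossed product are functions from `G` to `A`. -/
def coeffEquiv (α : G →* (A ≃⋆ₐ[ℂ] A)) : CrossedProduct α ≃ (G → A) where
  toFun := coeff
  invFun := mk
  left_inv _ := rfl
  right_inv _ := rfl

/-- The additive group structure is pointwise. -/
instance : AddCommGroup (CrossedProduct α) := (coeffEquiv α).addCommGroup

/-- Scalar multiplication is pointwise. -/
instance : Module ℂ (CrossedProduct α) := (coeffEquiv α).module ℂ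

@[simp] theorem coeff_add (x y : CrossedProduct α) (g : G) :
    (x + y).coeff g = x.coeff g + y.coeff g := rfl

@[simp] theorem coeff_zero (g : G) : (0 : CrossedProduct α).coeff g = 0 := rfl

@[simp] theorem coeff_smul (c : ℂ) (x : CrossedProduct α) (g : G) :
    (c • x).coeff g = c • x.coeff g := rfl

/-- Twisted convolution: `(x * y)(g) = ∑ h, x(h) α_h(y(h⁻¹ g))`. -/
instance : Mul (CrossedProduct α) :=
  ⟨fun x y => ⟨fun g => ∑ h, x.coeff h * α h (y.coeff (h⁻¹ * g))⟩⟩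

open Classical in
/-- The unit is the function that is `1` at the identity of `G` and `0` elsewhere. -/
instance : One (CrossedProduct α) := ⟨⟨fun g => if g = 1 then 1 else 0⟩⟩

/-- The involution: `(x⋆)(g) = α_g(x(g⁻¹)⋆)`. -/
instance : Star (CrossedProduct α) := ⟨fun x => ⟨fun g => α g (star (x.coeff g⁻¹))⟩⟩

theorem coeff_mul (x y : CrossedProduct α) (g : G) :
    (x * y).coeff g = ∑ h, x.coeff h * α h (y.coeff (h⁻¹ * g)) := rfl

open Classical in
theorem coeff_one (g : G) : (1 : CrossedProduct α).coeff g = if g = 1 then 1 else 0 := rfl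

theorem coeff_star (x : CrossedProduct α) (g : G) :
    (star x).coeff g = α g (star (x.coeff g⁻¹)) := rfl

/-- A covariant homomorphism from `(G, A, α)` to a unital C⋆-algebra `B`: a unital
⋆-homomorphism `π : A → B` and a homomorphism `u` from `G` to the unitary group of `B` with
`u g * π a * (u g)⋆ = π (α g a)`. For `B` the bounded operators on a Hilbert space these are the
covariant representations; as every C⋆-algebra acts faithfully on a Hilbert space, both
notions give the same universal norm. -/
structure CovariantHom (α : G →* (A ≃⋆ₐ[ℂ] A)) where
  /-- The target C⋆-algebra. -/
  B : Type (max u v)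
  /-- The target is a unital C⋆-algebra. -/
  [inst : CStarAlgebra B]
  /-- The homomorphism on `A`. -/
  π : A →⋆ₐ[ℂ] B
  /-- The unitaries that implement the action. -/
  u : G →* unitary B
  /-- The covariance condition. -/
  covariant : ∀ (g : G) (a : A), (u g : B) * π a * star (u g : B) = π (α g a)

attribute [instance] CovariantHom.inst

namespace CovariantHom

/-- The integrated form of a covariant homomorphism: `x ↦ ∑ g, π(x(g)) u_g`. -/
def integrate (ρ : CovariantHom α) (x : CrossedProduct α) : ρ.B :=
  ∑ g, ρ.π (x.coeff g) * (ρ.u g : ρ.B)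

variable (ρ : CovariantHom α)

theorem u_mul_π (g : G) (a : A) :
    (ρ.u g : ρ.B) * ρ.π a = ρ.π (α g a) * (ρ.u g : ρ.B) := by
  rw [← ρ.covariant, mul_assoc, Unitary.coe_star_mul_self, mul_one]

theorem integrate_add (x y : CrossedProduct α) :
    ρ.integrate (x + y) = ρ.integrate x + ρ.integrate y := by
  simp [integrate, add_mul, Finset.sum_add_distrib]

theorem integrate_zero : ρ.integrate (0 : CrossedProduct α) = 0 := by
  simp [integrate]

theorem integrate_smul (c : ℂ) (x : CrossedProduct α) :
    ρ.integrate (c • x) = c • ρ.integrate x := by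
  simp [integrate, Finset.smul_sum]

theorem integrate_one : ρ.integrate (1 : CrossedProduct α) = 1 := by
  classical
  rw [integrate, Finset.sum_eq_single 1]
  · simp [coeff_one]
  · intro g _ hg
    simp [coeff_one, hg]
  · simp

theorem integrate_mul (x y : CrossedProduct α) :
    ρ.integrate (x * y) = ρ.integrate x * ρ.integrate y := by
  simp only [integrate, coeff_mul, map_sum, Finset.sum_mul]
  rw [Finset.sum_comm]
  refine Finset.sum_congr rfl fun h _ => ?_
  rw [Finset.mul_sum]
  refine Fintype.sum_equiv (Equiv.mulLeft h⁻¹) _ _ fun g => ?_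
  have e : (ρ.u g : ρ.B) = ρ.u h * ρ.u (h⁻¹ * g) := by
    rw [← Submonoid.coe_mul, ← map_mul, mul_inv_cancel_left]
  rw [e, Equiv.coe_mulLeft, map_mul, mul_assoc, ← mul_assoc (ρ.π (α h _)), ← u_mul_π]
  simp only [mul_assoc]

theorem integrate_star (x : CrossedProduct α) :
    ρ.integrate (star x) = star (ρ.integrate x) := by
  simp only [integrate, coeff_star, star_sum, star_mul]
  refine Fintype.sum_equiv (Equiv.inv G) _ _ fun g => ?_
  have e : star (ρ.u g⁻¹ : ρ.B) = ρ.u g := by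
    rw [map_inv, ← Unitary.coe_star, Unitary.star_eq_inv, inv_inv]
  rw [← u_mul_π, map_star, Equiv.inv_apply, e]

theorem norm_integrate_le (x : CrossedProduct α) :
    ‖ρ.integrate x‖ ≤ ∑ g, ‖x.coeff g‖ := by
  refine norm_sum_le_of_le _ fun g _ => ?_
  rw [CStarRing.norm_mul_coe_unitary]
  exact NonUnitalStarAlgHom.norm_apply_le ρ.π _

end CovariantHom

section Regular

variable [DecidableEq G]

/-- The diagonal matrix with entries `α_{i⁻¹}(a)`. -/
def diagMatrix (α : G →* (A ≃⋆ₐ[ℂ] A)) (a : A) : Matrix G G A :=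
  Matrix.diagonal fun i => α i⁻¹ a

/-- The matrix of the left translation by `g` on `G`. -/
def permMatrix (A : Type u) [CStarAlgebra A] (g : G) : Matrix G G A :=
  Matrix.of fun i j => if i = g * j then 1 else 0

theorem permMatrix_mul_apply (g : G) (M : Matrix G G A) (i j : G) :
    (permMatrix A g * M) i j = M (g⁻¹ * i) j := by
  rw [Matrix.mul_apply, Finset.sum_eq_single (g⁻¹ * i)]
  · simp [permMatrix]
  · intro k _ hk
    have : i ≠ g * k := fun h => hk (by simp [h])
    simp [permMatrix, this]
  · simp

theorem mul_permMatrix_apply (g : G) (M : Matrix G G A) (i j : G) :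
    (M * permMatrix A g) i j = M i (g * j) := by
  simp [Matrix.mul_apply, permMatrix]

theorem permMatrix_one : permMatrix A (1 : G) = 1 := by
  ext i j
  simp [permMatrix, Matrix.one_apply]

theorem permMatrix_mul (g h : G) : permMatrix A (g * h) = permMatrix A g * permMatrix A h := by
  ext i j
  rw [mul_permMatrix_apply]
  simp [permMatrix, mul_assoc]

theorem star_permMatrix (g : G) : star (permMatrix A g) = permMatrix A g⁻¹ := by
  ext i j
  simp only [permMatrix, Matrix.star_apply, Matrix.of_apply, eq_inv_mul_iff_mul_eq,
    eq_comm (a := j)]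
  split_ifs <;> simp

theorem permMatrix_mem_unitary (g : G) :
    star (permMatrix A g) * permMatrix A g = 1 ∧ permMatrix A g * star (permMatrix A g) = 1 := by
  simp [star_permMatrix, ← permMatrix_mul, permMatrix_one]

theorem permMatrix_conj_diagMatrix (g : G) (a : A) :
    permMatrix A g * diagMatrix α a * star (permMatrix A g) = diagMatrix α (α g a) := by
  ext i j
  rw [star_permMatrix, mul_permMatrix_apply, permMatrix_mul_apply]
  by_cases h : i = j
  · subst h
    simp [diagMatrix]
  · simp [diagMatrix, h]

/-- The regular covariant homomorphism, to the matrices over `A` indexed by `G`. It is used to see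
that the universal seminorm is a norm. -/
def regularAux [PartialOrder A] [StarOrderedRing A] (α : G →* (A ≃⋆ₐ[ℂ] A)) : CovariantHom α where
  B := CStarMatrix G G A
  π :=
    { toFun := fun a => CStarMatrix.ofMatrix (diagMatrix α a)
      map_one' := show diagMatrix α 1 = 1 by simp [diagMatrix]
      map_mul' := fun a b => show diagMatrix α (a * b) = diagMatrix α a * diagMatrix α b by
        simp [diagMatrix]
      map_zero' := show diagMatrix α 0 = 0 by simp [diagMatrix]
      map_add' := fun a b => show diagMatrix α (a + b) = diagMatrix α a + diagMatrix α b by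
        simp [diagMatrix]
      commutes' := fun c => show diagMatrix α (algebraMap ℂ A c) = algebraMap ℂ (Matrix G G A) c by
        ext i j
        simp [diagMatrix, Matrix.algebraMap_matrix_apply, Matrix.diagonal_apply,
          Algebra.algebraMap_eq_smul_one]
      map_star' := fun a => show diagMatrix α (star a) = star (diagMatrix α a) by
        simp [diagMatrix, Matrix.star_eq_conjTranspose, Matrix.diagonal_conjTranspose, Pi.star_def,
          map_star] }
  u :=
    { toFun := fun g => ⟨CStarMatrix.ofMatrix (permMatrix A g), permMatrix_mem_unitary g⟩
      map_one' := Subtype.ext permMatrix_one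
      map_mul' := fun g h => Subtype.ext (permMatrix_mul g h) }
  covariant := permMatrix_conj_diagMatrix

theorem regularAux_integrate_apply [PartialOrder A] [StarOrderedRing A] (x : CrossedProduct α) :
    (regularAux α).integrate x =
      CStarMatrix.ofMatrix (∑ g, diagMatrix α (x.coeff g) * permMatrix A g) := rfl

theorem norm_coeff_le_regularAux [PartialOrder A] [StarOrderedRing A] (x : CrossedProduct α)
    (g : G) : ‖x.coeff g‖ ≤ ‖(regularAux α).integrate x‖ := by
  have h : (∑ k, diagMatrix α (x.coeff k) * permMatrix A k) g 1 = α g⁻¹ (x.coeff g) := by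
    rw [Matrix.sum_apply, Finset.sum_eq_single g]
    · rw [mul_permMatrix_apply]
      simp [diagMatrix]
    · intro k _ hk
      rw [mul_permMatrix_apply]
      simp [diagMatrix, hk.symm]
    · simp
  rw [← StarAlgEquiv.norm_map (α g⁻¹) (x.coeff g), ← h]
  exact CStarMatrix.norm_entry_le_norm (M := CStarMatrix.ofMatrix
    (∑ k, diagMatrix α (x.coeff k) * permMatrix A k))

end Regular

theorem exists_regular (α : G →* (A ≃⋆ₐ[ℂ] A)) :
    ∃ ρ : CovariantHom α, ∀ (x : CrossedProduct α) (g : G), ‖x.coeff g‖ ≤ ‖ρ.integrate x‖ := by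
  classical
  let _ : PartialOrder A := CStarAlgebra.spectralOrder A
  have : StarOrderedRing A := CStarAlgebra.spectralOrderedRing A
  exact ⟨regularAux α, norm_coeff_le_regularAux⟩

/-- A covariant homomorphism whose integrated form dominates the norms of the coefficients. -/
def regular (α : G →* (A ≃⋆ₐ[ℂ] A)) : CovariantHom α := (exists_regular α).choose

theorem norm_coeff_le_regular (x : CrossedProduct α) (g : G) :
    ‖x.coeff g‖ ≤ ‖(regular α).integrate x‖ :=
  (exists_regular α).choose_spec x g

theorem regular_injective : Function.Injective (regular α).integrate := by
  intro x y h
  ext g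
  have h1 := norm_coeff_le_regular (x + (-1 : ℂ) • y) g
  rw [coeff_add, coeff_smul, CovariantHom.integrate_add, CovariantHom.integrate_smul, h] at h1
  simpa [add_neg_eq_zero] using h1

instance : Ring (CrossedProduct α) :=
  { (inferInstance : AddCommGroup (CrossedProduct α)) with
    mul := (· * ·)
    one := 1
    mul_assoc := fun x y z => regular_injective (by
      simp only [CovariantHom.integrate_mul, mul_assoc])
    one_mul := fun x => regular_injective (by
      simp only [CovariantHom.integrate_mul, CovariantHom.integrate_one, one_mul])
    mul_one := fun x => regular_injective (by
      simp only [CovariantHom.integrate_mul, CovariantHom.integrate_one, mul_one])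
    zero_mul := fun x => regular_injective (by
      simp only [CovariantHom.integrate_mul, CovariantHom.integrate_zero, zero_mul])
    mul_zero := fun x => regular_injective (by
      simp only [CovariantHom.integrate_mul, CovariantHom.integrate_zero, mul_zero])
    left_distrib := fun x y z => regular_injective (by
      simp only [CovariantHom.integrate_mul, CovariantHom.integrate_add, mul_add])
    right_distrib := fun x y z => regular_injective (by
      simp only [CovariantHom.integrate_mul, CovariantHom.integrate_add, add_mul]) }

instance : StarRing (CrossedProduct α) where
  star_involutive x := regular_injective (by simp only [CovariantHom.integrate_star, star_star])
  star_mul x y := regular_injective (by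
    simp only [CovariantHom.integrate_star, CovariantHom.integrate_mul, star_mul])
  star_add x y := regular_injective (by
    simp only [CovariantHom.integrate_star, CovariantHom.integrate_add, star_add])

instance : Algebra ℂ (CrossedProduct α) :=
  Algebra.ofModule
    (fun c x y => regular_injective (by
      simp only [CovariantHom.integrate_mul, CovariantHom.integrate_smul, smul_mul_assoc]))
    (fun c x y => regular_injective (by
      simp only [CovariantHom.integrate_mul, CovariantHom.integrate_smul, mul_smul_comm]))

instance : StarModule ℂ (CrossedProduct α) where
  star_smul c x := regular_injective (by
    simp only [CovariantHom.integrate_star, CovariantHom.integrate_smul, star_smul])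

/-- The universal C⋆-norm: the supremum of the norms in all covariant homomorphisms. -/
instance : Norm (CrossedProduct α) := ⟨fun x => ⨆ ρ : CovariantHom α, ‖ρ.integrate x‖⟩

theorem norm_def (x : CrossedProduct α) : ‖x‖ = ⨆ ρ : CovariantHom α, ‖ρ.integrate x‖ := rfl

instance : Nonempty (CovariantHom α) := ⟨regular α⟩

theorem norm_integrate_le (ρ : CovariantHom α) (x : CrossedProduct α) :
    ‖ρ.integrate x‖ ≤ ‖x‖ :=
  le_ciSup (f := fun ρ : CovariantHom α => ‖ρ.integrate x‖)
    ⟨_, Set.forall_mem_range.2 fun ρ => ρ.norm_integrate_le x⟩ ρ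

theorem norm_le {x : CrossedProduct α} {r : ℝ} (h : ∀ ρ : CovariantHom α, ‖ρ.integrate x‖ ≤ r) :
    ‖x‖ ≤ r :=
  ciSup_le h

theorem norm_coeff_le (x : CrossedProduct α) (g : G) : ‖x.coeff g‖ ≤ ‖x‖ :=
  (norm_coeff_le_regular x g).trans (norm_integrate_le _ _)

/-- The universal norm is a submultiplicative norm. -/
def ringNorm (α : G →* (A ≃⋆ₐ[ℂ] A)) : RingNorm (CrossedProduct α) where
  toFun x := ‖x‖
  map_zero' := by simp [norm_def, CovariantHom.integrate_zero]
  add_le' x y := norm_le fun ρ => by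
    rw [ρ.integrate_add]
    exact (norm_add_le _ _).trans (add_le_add (norm_integrate_le ρ x) (norm_integrate_le ρ y))
  neg' x := by
    have h (ρ : CovariantHom α) : ρ.integrate (-x) = -ρ.integrate x := by
      rw [← neg_one_smul ℂ x, ρ.integrate_smul, neg_one_smul]
    simp only [norm_def, h, norm_neg]
  mul_le' x y := norm_le fun ρ => by
    rw [ρ.integrate_mul]
    exact (norm_mul_le _ _).trans (mul_le_mul (norm_integrate_le ρ x) (norm_integrate_le ρ y)
      (norm_nonneg _) ((norm_nonneg _).trans (norm_integrate_le ρ x)))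
  eq_zero_of_map_eq_zero' x hx := by
    ext g
    simpa using (norm_coeff_le x g).trans_eq hx

instance : NormedRing (CrossedProduct α) := (ringNorm α).toNormedRing

instance : NormedAlgebra ℂ (CrossedProduct α) where
  norm_smul_le c x := norm_le fun ρ => by
    rw [ρ.integrate_smul, norm_smul]
    exact mul_le_mul_of_nonneg_left (norm_integrate_le ρ x) (norm_nonneg c)

instance : CStarRing (CrossedProduct α) where
  norm_mul_self_le x := by
    have h : ‖x‖ ≤ √‖star x * x‖ := norm_le fun ρ => by
      apply Real.le_sqrt_of_sq_le
      rw [sq, ← CStarRing.norm_star_mul_self, ← ρ.integrate_star, ← ρ.integrate_mul]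
      exact norm_integrate_le ρ _
    calc ‖x‖ * ‖x‖ ≤ √‖star x * x‖ * √‖star x * x‖ :=
          mul_le_mul h h (norm_nonneg x) (Real.sqrt_nonneg _)
      _ = ‖star x * x‖ := Real.mul_self_sqrt (norm_nonneg _)

/-- The linear identification of the crossed product with the functions `G → A`, which is a
homeomorphism for the supremum norm on the latter. -/
def coeffCLE (α : G →* (A ≃⋆ₐ[ℂ] A)) : CrossedProduct α ≃L[ℂ] (G → A) :=
  LinearEquiv.toContinuousLinearEquivOfBounds
    { coeffEquiv α with
      map_add' := fun _ _ => rfl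
      map_smul' := fun _ _ => rfl } 1 (Fintype.card G)
    (fun x => by
      rw [one_mul, pi_norm_le_iff_of_nonneg (norm_nonneg x)]
      exact norm_coeff_le x)
    (fun f => norm_le fun ρ => (ρ.norm_integrate_le _).trans (by
      refine (Finset.sum_le_sum fun g _ => norm_le_pi_norm f g).trans ?_
      simp))

instance : CompleteSpace (CrossedProduct α) :=
  (completeSpace_congr (e := (coeffCLE α).toEquiv) (coeffCLE α).isUniformEmbedding).2
    inferInstance

/-- The crossed product is a unital C⋆-algebra. -/
instance : CStarAlgebra (CrossedProduct α) where

end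

end CrossedProduct

open Topology

/-! Up to a small error, the elements `e g * u g` are partial isometries with orthogonal ranges `e
g` and common source `e 1`, and `a * u k ≈ ∑ g, (e g * u g) * α g⁻¹ a * star (e (k⁻¹ * g) * u (k⁻¹ *
g))`. The crossed product thus looks locally like matrices, indexed by `G`, over a corner of `A`. A
finite dimensional `E ⊆ A` contains a projection `p` near `e 1` and approximants of the `α g⁻¹ a`.
Exact partial isometries `w g` with source `p` then make the span of the `w g * b * star (w h)`, `b
∈ E`, a finite dimensional algebra close to the given elements (`exists_rokhlin_partialIsometries`,
`exists_finiteDimensional_near`).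

It remains to pass from local approximation to an increasing sequence. By a perturbation argument of
Glimm, matrix units close to a closed subalgebra are conjugated into it by a unitary close to `1`
(`exists_unitary_conj_mem`). Each new approximating algebra can therefore be rotated slightly so as
to contain the previous one (`exists_ge`), and separability lets countably many such steps suffice
(`isAFAlgebra`). -/

/-! ### Perturbation by functional calculus: polar parts and orthogonal projections -/

theorem exists_inverse_sqrt {B : Type*} [CStarAlgebra B] {c : B} (hc : IsSelfAdjoint c) {δ : ℝ}
    (hδ : δ ≤ 1 / 2) (h : ‖c - 1‖ ≤ δ) :
    ∃ s : B, IsSelfAdjoint s ∧ s * s * c = 1 ∧ Commute s c ∧ ‖s - 1‖ ≤ δ ∧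
      ∀ E : StarSubalgebra ℂ B, IsClosed (E : Set B) → c ∈ E → s ∈ E := by
  have hspec : ∀ t ∈ spectrum ℝ c, |t - 1| ≤ δ := fun t ht => by
    rcases subsingleton_or_nontrivial B with _ | _
    · simp at ht
    have h1 : t - 1 ∈ spectrum ℝ (c - 1) := by
      have := (spectrum.sub_singleton_eq c (1 : ℝ)).symm ▸ Set.sub_mem_sub ht (Set.mem_singleton _)
      simpa using this
    exact (spectrum.norm_le_norm_of_mem h1).trans h
  have hpos : ∀ t ∈ spectrum ℝ c, 1 / 2 ≤ t := fun t ht => by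
    linarith [abs_le.1 (hspec t ht)]
  have hcont : ContinuousOn (fun t : ℝ => (√t)⁻¹) (spectrum ℝ c) :=
    Real.continuous_sqrt.continuousOn.inv₀ fun t ht =>
      (Real.sqrt_pos.2 (by linarith [hpos t ht])).ne'
  have hδ0 : 0 ≤ δ := (norm_nonneg _).trans h
  refine ⟨cfc (fun t : ℝ => (√t)⁻¹) c, cfc_predicate _ _, ?_, ?_, ?_, ?_⟩
  · conv_lhs => rw [← cfc_mul (fun t : ℝ => (√t)⁻¹) (fun t : ℝ => (√t)⁻¹) c]; arg 2; rw [← cfc_id ℝ c]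
    rw [← cfc_mul (fun t : ℝ => (√t)⁻¹ * (√t)⁻¹) id c (hcont.mul hcont), ← cfc_one ℝ c]
    refine cfc_congr fun t ht => ?_
    have ht := hpos t ht
    have := Real.mul_self_sqrt (show 0 ≤ t by linarith)
    have h2 : √t ≠ 0 := (Real.sqrt_pos.2 (by linarith)).ne'
    simp only [id, Pi.one_apply]
    field_simp
    linarith
  · have := cfc_commute_cfc (fun t : ℝ => (√t)⁻¹) id c
    rwa [cfc_id ℝ c] at this
  · rw [← cfc_one ℝ c, ← cfc_sub _ _ c hcont]
    refine norm_cfc_le hδ0 fun t ht => ?_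
    have h1 := hpos t ht
    have h2 := hspec t ht
    have h3 : 0 < √t := Real.sqrt_pos.2 (by linarith)
    have h4 := Real.mul_self_sqrt (show 0 ≤ t by linarith)
    have h5 : 1 / 2 ≤ √t := by nlinarith
    -- The denominator is `√t + t ≥ 1 / 2 + 1 / 2`, so passing to the inverse root costs no
    -- constant.
    have h6 : (√t)⁻¹ - 1 = -(t - 1) * (√t * (1 + √t))⁻¹ := by
      field_simp
      nlinarith
    rw [Pi.one_apply, h6, Real.norm_eq_abs, abs_mul, abs_neg]
    have h7 : |(√t * (1 + √t))⁻¹| ≤ 1 := by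
      rw [abs_of_pos (by positivity)]
      exact inv_le_one_of_one_le₀ (by nlinarith)
    calc _ ≤ δ * 1 := mul_le_mul h2 h7 (abs_nonneg _) hδ0
      _ = δ := mul_one δ
  · intro E hE hcE
    have : IsClosed (E : Set B) := hE
    exact cfc_mem _ hcE

/-- Polar decomposition of an element that is nearly a partial isometry. -/
theorem exists_polar {B : Type*} [CStarAlgebra B] {y p : B} (hp : IsStarProjection p)
    (hy : y * p = y) {δ : ℝ} (hδ : δ ≤ 1 / 2) (h : ‖star y * y - p‖ ≤ δ) :
    ∃ s : B, star (y * s) * (y * s) = p ∧ y * s * p = y * s ∧ ‖s - 1‖ ≤ δ ∧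
      ∀ E : StarSubalgebra ℂ B, IsClosed (E : Set B) → star y * y ∈ E → p ∈ E → s ∈ E := by
  have hpp := hp.isIdempotentElem.eq
  have hps := hp.isSelfAdjoint.star_eq
  have hy' : p * star y = star y := by
    conv_rhs => rw [← hy, star_mul, hps]
  -- Adding `1 - p` replaces inversion of `star y * y` in the corner of `p` by inversion of an
  -- element near `1` in `B`.
  have hcp : Commute p (star y * y + (1 - p)) := by
    rw [Commute, SemiconjBy, mul_add, add_mul, ← mul_assoc, hy', mul_assoc (star y), hy, mul_sub,
      sub_mul, mul_one, one_mul]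
  have hsa : IsSelfAdjoint (star y * y + (1 - p)) :=
    (IsSelfAdjoint.star_mul_self y).add ((IsSelfAdjoint.one B).sub hp.isSelfAdjoint)
  have hc1 : ‖star y * y + (1 - p) - 1‖ ≤ δ := by
    convert h using 2
    abel
  obtain ⟨s, hs, hs1, hs2, hs3, hs4⟩ := exists_inverse_sqrt hsa hδ hc1
  have hsp : Commute s p := by
    -- A centralizer is a closed star subalgebra, so the membership clause for `s` also yields
    -- commutation.
    have := hs4 (StarSubalgebra.centralizer ℂ {p}) (by
      rw [StarSubalgebra.coe_centralizer]; exact Set.isClosed_centralizer _) (by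
      rw [StarSubalgebra.mem_centralizer_iff]
      rintro g rfl
      exact ⟨hcp.eq, by rw [hps]; exact hcp.eq⟩)
    rw [StarSubalgebra.mem_centralizer_iff] at this
    exact ((this p rfl).1).symm
  have hpc : star y * y = p * (star y * y + (1 - p)) := by
    rw [mul_add, ← mul_assoc, hy', mul_sub, mul_one, hpp, sub_self, add_zero]
  refine ⟨s, ?_, ?_, hs3, ?_⟩
  · rw [star_mul, hs.star_eq, mul_assoc, ← mul_assoc (star y), hpc, ← mul_assoc, ← mul_assoc, hsp.eq,
      mul_assoc p, mul_assoc p, hs2.eq, mul_assoc, ← (hs2.mul_left hs2).eq, hs1, mul_one]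
  · rw [mul_assoc, hsp.eq, ← mul_assoc, hy]
  · intro E hE h1 h2
    exact hs4 E hE (add_mem h1 (sub_mem (one_mem _) h2))

theorem norm_realPart_sub_le {B : Type*} [CStarAlgebra B] {p : B} (hp : IsSelfAdjoint p) (x : B) :
    ‖(realPart x : B) - p‖ ≤ ‖x - p‖ := by
  have : (realPart x : B) - p = realPart (x - p) := by
    rw [map_sub, AddSubgroupClass.coe_sub, hp.coe_realPart]
  rw [this]
  simpa using realPart.norm_le (x - p)

/-- The map sending a family of scalars to the linear combination of a complete family of
orthogonal projections. -/
noncomputable def projectionsHom {B ι : Type*} [CStarAlgebra B] [Fintype ι] (p : ι → B)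
    (hp : ∀ i, IsStarProjection (p i)) (hpp : ∀ i j, i ≠ j → p i * p j = 0) (h1 : ∑ i, p i = 1) :
    (ι → ℂ) →⋆ₐ[ℂ] B where
  toFun c := ∑ i, c i • p i
  map_one' := by simpa using h1
  map_mul' c d := by
    simp only [Finset.sum_mul, Pi.mul_apply]
    refine Finset.sum_congr rfl fun i _ => ?_
    rw [Finset.mul_sum, Finset.sum_eq_single i]
    · rw [smul_mul_smul_comm, (hp i).isIdempotentElem.eq]
    · intro j _ hj
      rw [smul_mul_smul_comm, hpp i j hj.symm, smul_zero]
    · simp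
  map_zero' := by simp
  map_add' c d := by simp [add_smul, Finset.sum_add_distrib]
  commutes' c := by
    simp only [Pi.algebraMap_apply, Algebra.algebraMap_self, RingHom.id_apply]
    rw [← Finset.smul_sum, h1, Algebra.algebraMap_eq_smul_one]
  map_star' c := by
    simp [star_sum, (hp _).isSelfAdjoint.star_eq]

/-- A bump function that is `1` near `k` and `0` at distance at least `2 / 3` from `k`. -/
noncomputable def bump (k t : ℝ) : ℝ := max 0 (min 1 (2 - 3 * |t - k|))

theorem continuous_bump (k : ℝ) : Continuous (bump k) := by
  unfold bump
  fun_prop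

theorem bump_of_near {k t : ℝ} (h : |t - k| ≤ 1 / 4) : bump k t = 1 := by
  rw [bump, min_eq_left (by linarith), max_eq_right zero_le_one]

theorem bump_of_far {k t : ℝ} (h : 3 / 4 ≤ |t - k|) : bump k t = 0 :=
  max_eq_left ((min_le_right _ _).trans (by linarith))

/-- The family is encoded in one self-adjoint element `a = ∑ n i • p i` with distinct natural
numbers `n i`, from which `p i` is recovered as a bump function of `a`. A self-adjoint `b ∈ E` near
`a` has spectrum near the `n i`, where the bumps take only the values `0` and `1`; they turn `b`
into orthogonal projections in `E`. Continuity of the functional calculus gives closeness, with `δ`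
independent of `E`. -/
theorem exists_projections_near {B ι : Type*} [CStarAlgebra B] [Fintype ι] {p : ι → B}
    (hp : ∀ i, IsStarProjection (p i)) (hpp : ∀ i j, i ≠ j → p i * p j = 0) (h1 : ∑ i, p i = 1)
    {ε : ℝ} (hε : 0 < ε) :
    ∃ δ > 0, ∀ E : StarSubalgebra ℂ B, IsClosed (E : Set B) → (∀ i, ∃ x ∈ E, ‖x - p i‖ < δ) →
      ∃ q : ι → B, (∀ i, q i ∈ E) ∧ (∀ i, IsStarProjection (q i)) ∧
        (∀ i j, i ≠ j → q i * q j = 0) ∧ ∀ i, ‖q i - p i‖ < ε := by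
  obtain ⟨n, hn⟩ : ∃ n : ι → ℕ, Function.Injective n :=
    ⟨fun i => Fintype.equivFin ι i, Fin.val_injective.comp (Fintype.equivFin ι).injective⟩
  have hsep : ∀ i j, ∀ t : ℝ, i ≠ j → |t - n i| ≤ 1 / 4 → 3 / 4 ≤ |t - n j| := fun i j t hij ht => by
    have : (1 : ℝ) ≤ |(n i : ℝ) - n j| := by
      have h0 : (n i : ℤ) - n j ≠ 0 := by
        rw [sub_ne_zero]
        exact_mod_cast hn.ne hij
      exact_mod_cast Int.one_le_abs h0
    have h2 := abs_sub_le (n i : ℝ) t (n j)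
    rw [abs_sub_comm (n i : ℝ) t] at h2
    linarith
  set φ := projectionsHom p hp hpp h1
  set c : ι → ℂ := fun i => ((n i : ℝ) : ℂ)
  have hcsa : IsSelfAdjoint c := funext fun i => Complex.conj_ofReal _
  set a := φ c
  have hasa : IsSelfAdjoint a := hcsa.map φ
  have hφ : Continuous φ := (LinearMap.continuous_of_finiteDimensional φ.toAlgHom.toLinearMap)
  have hspec : spectrum ℝ a ⊆ Set.range fun i => (n i : ℝ) := by
    intro t ht
    rw [← spectrum.preimage_algebraMap ℂ, Set.mem_preimage] at ht
    have ht := AlgHom.spectrum_apply_subset φ c ht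
    rw [Pi.spectrum_eq, Set.mem_iUnion] at ht
    obtain ⟨i, hi⟩ := ht
    refine ⟨i, ?_⟩
    rw [spectrum.mem_iff, Algebra.algebraMap_self, RingHom.id_apply, isUnit_iff_ne_zero, not_not,
      sub_eq_zero] at hi
    exact (Complex.ofReal_injective hi).symm
  set s : Set ℝ := ⋃ i, Metric.closedBall (n i : ℝ) (1 / 4)
  have hs : IsCompact s := isCompact_iUnion fun i => isCompact_closedBall _ _
  have hsn : s ∈ 𝓝ˢ (spectrum ℝ a) := by
    rw [mem_nhdsSet_iff_forall]
    intro t ht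
    obtain ⟨i, rfl⟩ := hspec ht
    exact Filter.mem_of_superset (Metric.closedBall_mem_nhds _ (by norm_num))
      (Set.subset_iUnion (fun i => Metric.closedBall (n i : ℝ) (1 / 4)) i)
  have hq : ∀ i, cfc (bump (n i)) a = p i := fun i => by
    classical
    -- On the finite spectrum of `a` the bump is a polynomial, and polynomials pass through `φ`.
    set P := Lagrange.interpolate Finset.univ (fun j => (n j : ℝ)) fun j => bump (n i) (n j)
    have hP (j : ι) : P.eval (n j : ℝ) = bump (n i) (n j) :=
      Lagrange.eval_interpolate_at_node _ (Nat.cast_injective.comp hn).injOn (Finset.mem_univ j)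
    have h2 : cfc (bump (n i)) a = cfc (fun t => P.eval t) a := cfc_congr fun t ht => by
      obtain ⟨j, rfl⟩ := hspec ht
      exact (hP j).symm
    rw [h2, cfc_polynomial P a, ← Polynomial.aeval_map_algebraMap ℂ a P,
      show a = (φ : (ι → ℂ) →ₐ[ℂ] B) c from rfl, Polynomial.aeval_algHom_apply]
    have h3 : Polynomial.aeval c (P.map (algebraMap ℝ ℂ)) = fun j => if j = i then 1 else 0 := by
      funext j
      have := Polynomial.aeval_algHom_apply (Pi.evalAlgHom ℂ (fun _ : ι => ℂ) j) c
        (P.map (algebraMap ℝ ℂ))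
      rw [Pi.evalAlgHom_apply, Pi.evalAlgHom_apply] at this
      rw [← this, show c j = algebraMap ℝ ℂ (n j) from rfl, Polynomial.aeval_map_algebraMap,
        Polynomial.aeval_algebraMap_apply, Polynomial.coe_aeval_eq_eval, hP]
      split_ifs with h
      · rw [h, bump_of_near (by simp), map_one]
      · rw [bump_of_far (hsep j i _ h (by simp)), map_zero]
    rw [h3]
    show ∑ j, (if j = i then (1 : ℂ) else 0) • p j = p i
    simp
  have hev : ∀ᶠ x in 𝓝[{x | IsSelfAdjoint x}] a,
      IsSelfAdjoint x ∧ spectrum ℝ x ⊆ s ∧ ∀ i, ‖cfc (bump (n i)) x - p i‖ < ε := by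
    have e1 : ∀ᶠ x in 𝓝[{x | IsSelfAdjoint x}] a, IsSelfAdjoint x := self_mem_nhdsWithin
    have e2 : ∀ᶠ x in 𝓝[{x | IsSelfAdjoint x}] a, spectrum ℝ x ⊆ s :=
      nhdsWithin_le_nhds
        (upperHemicontinuous_iff_preimage_Iic.1 (upperHemicontinuous_spectrum ℝ B) a s hsn :
          ∀ᶠ x in 𝓝 a, spectrum ℝ x ⊆ s)
    refine e1.and (e2.and (Filter.eventually_all.2 fun i => ?_))
    have h3 := Filter.Tendsto.cfc hs (bump (n i)) (Filter.tendsto_id'.2 nhdsWithin_le_nhds) e2 e1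
      (subset_of_mem_nhdsSet hsn) hasa (continuous_bump _).continuousOn
    rw [hq] at h3
    simpa [dist_eq_norm] using h3.eventually (Metric.ball_mem_nhds _ hε)
  obtain ⟨η, hη, hη'⟩ := Metric.mem_nhdsWithin_iff.1 hev
  have hN : 0 < ∑ i, (n i : ℝ) + 1 := by positivity
  -- The errors enter `b - a` with weights `n i`; the `+ 1` covers a zero sum of weights.
  refine ⟨η / (∑ i, (n i : ℝ) + 1), div_pos hη hN, fun E hE hx => ?_⟩
  choose x hxE hx using hx
  have : IsClosed (E : Set B) := hE
  -- Real parts make `b` self-adjoint without leaving `E` or moving away from the `p i`.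
  set b : B := ∑ i, (n i : ℂ) • (realPart (x i) : B)
  have hbE : b ∈ E := sum_mem fun i _ => by
    rw [realPart_apply_coe]
    have h2 : (2⁻¹ : ℝ) • (x i + star (x i)) = (2⁻¹ : ℂ) • (x i + star (x i)) := by
      rw [← Complex.coe_smul]
      norm_num
    rw [h2]
    exact SMulMemClass.smul_mem _ (SMulMemClass.smul_mem _ (add_mem (hxE i) (star_mem (hxE i))))
  have hb : IsSelfAdjoint b := by
    rw [isSelfAdjoint_iff, star_sum]
    refine Finset.sum_congr rfl fun i _ => ?_
    rw [star_smul, (realPart (x i)).2.star_eq, Complex.star_def, Complex.conj_natCast]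
  have hba : ‖b - a‖ < η := by
    have h2 : b - a = ∑ i, (n i : ℂ) • ((realPart (x i) : B) - p i) := by
      simp only [smul_sub, Finset.sum_sub_distrib]
      rfl
    have h3 : ‖b - a‖ ≤ ∑ i, (n i : ℝ) * (η / (∑ i, (n i : ℝ) + 1)) := by
      rw [h2]
      refine norm_sum_le_of_le _ fun i _ => ?_
      rw [norm_smul, Complex.norm_natCast]
      exact mul_le_mul_of_nonneg_left
        ((norm_realPart_sub_le (hp i).isSelfAdjoint _).trans (hx i).le) (Nat.cast_nonneg _)
    refine h3.trans_lt ?_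
    rw [← Finset.sum_mul, ← mul_div_assoc, div_lt_iff₀ hN]
    nlinarith
  obtain ⟨-, hbs, hbp⟩ := hη' ⟨by simpa [dist_eq_norm] using hba, hb⟩
  have hmul (i j : ι) : cfc (bump (n i)) b * cfc (bump (n j)) b =
      cfc (fun t => bump (n i) t * bump (n j) t) b :=
    (cfc_mul _ _ _ (continuous_bump _).continuousOn (continuous_bump _).continuousOn).symm
  have hval : ∀ t ∈ spectrum ℝ b, ∃ i, |t - n i| ≤ 1 / 4 := fun t ht => by
    simpa [s, Real.dist_eq] using hbs ht
  refine ⟨fun i => cfc (bump (n i)) b, fun i => cfc_mem _ hbE, fun i => ⟨?_, cfc_predicate _ _⟩,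
    fun i j hij => ?_, hbp⟩
  · rw [IsIdempotentElem, hmul]
    refine cfc_congr fun t ht => ?_
    obtain ⟨k, hk⟩ := hval t ht
    rcases eq_or_ne k i with rfl | h
    · simp [bump_of_near hk]
    · simp [bump_of_far (hsep k i t h hk)]
  · rw [hmul, ← cfc_zero ℝ b]
    refine cfc_congr fun t ht => ?_
    obtain ⟨k, hk⟩ := hval t ht
    rcases eq_or_ne k i with rfl | h
    · simp [bump_of_far (hsep k j t hij hk)]
    · simp [bump_of_far (hsep k i t h hk)]

/-! ### Perturbation of matrix units -/

/-- A complete family of partial isometries `v i` with orthogonal ranges, such that the source of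
`v i` is the range of `v (r i)`. The elements `v i * star (v j)` with `r i = r j` are then the
matrix units of a direct sum of matrix algebras. -/
structure IsMatrixFamily {B ι : Type*} [CStarAlgebra B] [Fintype ι] (v : ι → B) (r : ι → ι) :
    Prop where
  ortho : ∀ i j, i ≠ j → star (v i) * v j = 0
  source : ∀ i, star (v i) * v i = v (r i) * star (v (r i))
  isometry : ∀ i, v i * (star (v i) * v i) = v i
  sum_range : ∑ i, v i * star (v i) = 1

namespace IsMatrixFamily

variable {B ι : Type*} [CStarAlgebra B] [Fintype ι] {v : ι → B} {r : ι → ι}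

theorem isStarProjection (h : IsMatrixFamily v r) (i : ι) : IsStarProjection (v i * star (v i)) :=
  ⟨by rw [IsIdempotentElem, ← mul_assoc, mul_assoc (v i) (star (v i)), h.isometry],
    IsSelfAdjoint.mul_star_self _⟩

theorem mul_source (h : IsMatrixFamily v r) {i j : ι} (hij : r i = r j) :
    v i * (star (v j) * v j) = v i := by
  rw [h.source, ← hij, ← h.source, h.isometry]

theorem norm_le (h : IsMatrixFamily v r) (i : ι) : ‖v i‖ ≤ 1 := by
  have := IsStarProjection.norm_le _ (h.isStarProjection i)
  rw [CStarRing.norm_self_mul_star] at this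
  nlinarith [norm_nonneg (v i)]

theorem range_mul_range (h : IsMatrixFamily v r) {i j : ι} (hij : i ≠ j) :
    v i * star (v i) * (v j * star (v j)) = 0 := by
  rw [mul_assoc, ← mul_assoc (star (v i)), h.ortho i j hij, zero_mul, mul_zero]

/-- The range projections are first moved to orthogonal projections `q i` in `E`. Cutting the
approximants down to `q i * x i * q (r i)` and taking polar parts makes the relations exact: ranges
lie under the `q i`, and the sources are the `q (r i)`. -/
theorem exists_partialIsometries_near (h : IsMatrixFamily v r) {ε : ℝ} (hε : 0 < ε) :
    ∃ δ > 0, ∀ E : StarSubalgebra ℂ B, IsClosed (E : Set B) → (∀ i, ∃ x ∈ E, ‖x - v i‖ < δ) →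
      ∃ w : ι → B, (∀ i, w i ∈ E) ∧ (∀ i j, i ≠ j → star (w i) * w j = 0) ∧
        (∀ i j, r i = r j → w i * (star (w j) * w j) = w i) ∧ ∀ i, ‖w i - v i‖ < ε := by
  -- The polar decomposition needs `10 * η ≤ 1 / 2`; the final error is `20 * η + 3 * η < ε`.
  set η := min (ε / 24) (1 / 20)
  have hη : 0 < η := lt_min (by positivity) (by norm_num)
  have hη1 : η ≤ 1 / 20 := min_le_right _ _
  have hη2 : η ≤ ε / 24 := min_le_left _ _
  obtain ⟨δ, hδ, H⟩ := exists_projections_near h.isStarProjection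
    (fun i j hij => h.range_mul_range hij) h.sum_range hη
  -- Since `‖x i‖ ≤ 2` and `‖v i‖ ≤ 1`, passing to `x i * star (x i)` at most triples the error.
  refine ⟨min η (δ / 3), lt_min hη (by positivity), fun E hE hx => ?_⟩
  choose x hxE hx using hx
  have hx1 (i : ι) : ‖x i - v i‖ ≤ η := (hx i).le.trans (min_le_left _ _)
  have hx2 (i : ι) : ‖x i - v i‖ < δ / 3 := (hx i).trans_le (min_le_right _ _)
  have hxn (i : ι) : ‖x i‖ ≤ 2 := by
    have := norm_le_norm_add_norm_sub' (x i) (v i)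
    linarith [hx1 i, h.norm_le i]
  obtain ⟨q, hqE, hq, hqq, hqp⟩ := H E hE fun i => ⟨x i * star (x i),
    mul_mem (hxE i) (star_mem (hxE i)), by
      have e : x i * star (x i) - v i * star (v i) =
          x i * star (x i - v i) + (x i - v i) * star (v i) := by
        rw [star_sub, mul_sub, sub_mul]; abel
      rw [e]
      have h1 := norm_mul_le (x i) (star (x i - v i))
      have h2 := norm_mul_le (x i - v i) (star (v i))
      rw [norm_star] at h1 h2
      have h3 := norm_add_le (x i * star (x i - v i)) ((x i - v i) * star (v i))
      nlinarith [hx2 i, hxn i, h.norm_le i, norm_nonneg (x i - v i)]⟩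
  have hqn (i : ι) : ‖q i‖ ≤ 1 := IsStarProjection.norm_le _ (hq i)
  set y : ι → B := fun i => q i * x i * q (r i)
  have hyE (i : ι) : y i ∈ E := mul_mem (mul_mem (hqE i) (hxE i)) (hqE _)
  have hyn (i : ι) : ‖y i‖ ≤ 2 := by
    calc ‖y i‖ ≤ ‖q i‖ * ‖x i‖ * ‖q (r i)‖ := norm_mul₃_le
      _ ≤ 1 * 2 * 1 := by gcongr <;> simp [hqn, hxn]
      _ = 2 := by norm_num
  have hyq (i : ι) : y i * q (r i) = y i := by
    simp only [y, mul_assoc, (hq _).isIdempotentElem.eq]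
  have hqy (i : ι) : q i * y i = y i := by
    simp only [y, ← mul_assoc, (hq _).isIdempotentElem.eq]
  have hyv (i : ι) : ‖y i - v i‖ ≤ 3 * η := by
    have e : y i - v i = q i * (x i - v i) * q (r i) +
        (q i - v i * star (v i)) * v i * q (r i) +
        v i * (q (r i) - v (r i) * star (v (r i))) := by
      have h1 : v i * star (v i) * v i = v i := by rw [mul_assoc, h.isometry]
      rw [← h.source, mul_sub, sub_mul, sub_mul, sub_mul, h1, mul_sub, h.isometry]
      abel
    rw [e]
    refine (norm_add₃_le).trans ?_
    have h1 : ‖q i * (x i - v i) * q (r i)‖ ≤ 1 * η * 1 :=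
      norm_mul₃_le.trans (by gcongr <;> simp [hqn, hx1])
    have h2 : ‖(q i - v i * star (v i)) * v i * q (r i)‖ ≤ η * 1 * 1 :=
      norm_mul₃_le.trans (by gcongr <;> simp [hqn, (hqp _).le, h.norm_le])
    have h3 : ‖v i * (q (r i) - v (r i) * star (v (r i)))‖ ≤ 1 * η :=
      (norm_mul_le _ _).trans (by gcongr <;> simp [(hqp _).le, h.norm_le])
    linarith
  have hyy (i : ι) : ‖star (y i) * y i - q (r i)‖ ≤ 10 * η := by
    have e : star (y i) * y i - q (r i) = star (y i) * (y i - v i) + star (y i - v i) * v i +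
        -(q (r i) - v (r i) * star (v (r i))) := by
      rw [← h.source, star_sub, mul_sub, sub_mul]; abel
    rw [e]
    refine (norm_add₃_le).trans ?_
    have h1 : ‖star (y i) * (y i - v i)‖ ≤ 2 * (3 * η) :=
      (norm_mul_le _ _).trans (by rw [norm_star]; gcongr <;> simp [hyn, hyv])
    have h2 : ‖star (y i - v i) * v i‖ ≤ (3 * η) * 1 :=
      (norm_mul_le _ _).trans (by rw [norm_star]; gcongr <;> simp [h.norm_le, hyv])
    have h3 := (hqp (r i)).le
    rw [norm_neg]
    linarith
  choose s hs1 hs2 hs3 hs4 using fun i =>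
    exists_polar (hq (r i)) (hyq i) (by linarith : 10 * η ≤ 1 / 2) (hyy i)
  refine ⟨fun i => y i * s i, fun i => mul_mem (hyE i)
    (hs4 i E hE (mul_mem (star_mem (hyE i)) (hyE i)) (hqE _)), fun i j hij => ?_,
    fun i j hij => ?_, fun i => ?_⟩
  · have e : star (y i) * y j = 0 := by
      rw [← hqy i, ← hqy j, star_mul, (hq i).isSelfAdjoint.star_eq, mul_assoc, ← mul_assoc (q i),
        hqq i j hij, zero_mul, mul_zero]
    rw [star_mul, mul_assoc, ← mul_assoc (star (y i)), e, zero_mul, mul_zero]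
  · rw [hs1, ← hij, hs2]
  · have e : y i * s i - v i = y i * (s i - 1) + (y i - v i) := by
      rw [mul_sub, mul_one]; abel
    rw [e]
    refine (norm_add_le _ _).trans_lt ?_
    have h1 : ‖y i * (s i - 1)‖ ≤ 2 * (10 * η) :=
      (norm_mul_le _ _).trans (by gcongr <;> simp [hyn, hs3])
    linarith [hyv i]

/-- Partial isometries close to a matrix family are conjugate to it by a unitary close to `1`. -/
theorem exists_unitary (h : IsMatrixFamily v r) {w : ι → B}
    (hw : ∀ i j, i ≠ j → star (w i) * w j = 0)
    (hw' : ∀ i j, r i = r j → w i * (star (w j) * w j) = w i) {θ : ℝ} (hθ : θ ≤ 1 / 6)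
    (hwv : ∑ i, ‖w i - v i‖ ≤ θ) :
    ∃ u : unitary B, ‖(u : B) - 1‖ ≤ 7 * θ ∧
      ∀ i j, r i = r j → (u : B) * (v i * star (v j)) * star (u : B) = w i * star (w j) := by
  have hθ0 : 0 ≤ θ := (Finset.sum_nonneg fun i _ => norm_nonneg _).trans hwv
  -- `z` is close to `∑ v i * star (v i) = 1` and intertwines the two systems of matrix units; its
  -- polar part is the required unitary.
  set z : B := ∑ i, w i * star (v i)
  have hz1 : ‖z - 1‖ ≤ θ := by
    have e : z - 1 = ∑ i, (w i - v i) * star (v i) := by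
      simp only [sub_mul, Finset.sum_sub_distrib, h.sum_range, z]
    rw [e]
    refine (norm_sum_le_of_le _ fun i _ => ?_).trans hwv
    refine (norm_mul_le _ _).trans ?_
    rw [norm_star]
    exact mul_le_of_le_one_right (norm_nonneg _) (h.norm_le i)
  have hzv (i j : ι) (hij : r i = r j) : z * (v i * star (v j)) = w i * star (v j) := by
    rw [Finset.sum_mul, Finset.sum_eq_single i]
    · have h1 : star (v i) * v i * star (v j) = star (v j) := by
        have := congrArg star (h.mul_source hij.symm)
        rwa [star_mul, star_mul, star_star] at this
      rw [mul_assoc, ← mul_assoc (star (v i)), h1]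
    · intro k _ hk
      rw [mul_assoc, ← mul_assoc (star (v k)), h.ortho k i hk, zero_mul, mul_zero]
    · simp
  have hwz (i j : ι) (hij : r i = r j) : w i * star (w j) * z = w i * star (v j) := by
    rw [Finset.mul_sum, Finset.sum_eq_single j]
    · rw [← mul_assoc, mul_assoc (w i), hw' i j hij]
    · intro k _ hk
      rw [← mul_assoc, mul_assoc (w i), hw j k hk.symm, mul_zero, zero_mul]
    · simp
  have hint (i j : ι) (hij : r i = r j) : z * (v i * star (v j)) = w i * star (w j) * z :=
    (hzv i j hij).trans (hwz i j hij).symm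
  have hint' (i j : ι) (hij : r i = r j) : v i * star (v j) * star z = star z * (w i * star (w j)) := by
    have := congrArg star (hint j i hij.symm)
    simpa [star_mul, mul_assoc] using this
  have hzn : ‖z‖ ≤ 1 + θ := by
    have := norm_le_norm_add_norm_sub' z 1
    have h1 : ‖(1 : B)‖ ≤ 1 := IsStarProjection.norm_le _ (IsStarProjection.one B)
    linarith
  have hzz : ‖star z * z - 1‖ ≤ 3 * θ := by
    have e : star z * z - 1 = star z * (z - 1) + star (z - 1) := by
      rw [mul_sub, star_sub, star_one, mul_one]; abel
    rw [e]
    refine (norm_add_le _ _).trans ?_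
    have h1 : ‖star z * (z - 1)‖ ≤ (1 + θ) * θ :=
      (norm_mul_le _ _).trans (by rw [norm_star]; gcongr)
    rw [norm_star]
    nlinarith
  obtain ⟨s, hs1, -, hs3, hs4⟩ := exists_polar (IsStarProjection.one B) (mul_one z)
    (by linarith : 3 * θ ≤ 1 / 2) hzz
  -- `star z * z` commutes with the matrix units, hence so does `s`, and `z * s` still intertwines.
  have hsv (i j : ι) (hij : r i = r j) : v i * star (v j) * s = s * (v i * star (v j)) := by
    have hcomm (i j : ι) (hij : r i = r j) :
        v i * star (v j) * (star z * z) = star z * z * (v i * star (v j)) := by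
      rw [← mul_assoc, hint' i j hij, mul_assoc, ← hint i j hij, mul_assoc]
    have := hs4 (StarSubalgebra.centralizer ℂ {v i * star (v j)})
      (by rw [StarSubalgebra.coe_centralizer]; exact Set.isClosed_centralizer _) (by
        rw [StarSubalgebra.mem_centralizer_iff]
        rintro g rfl
        refine ⟨hcomm i j hij, ?_⟩
        rw [star_mul, star_star]
        exact hcomm j i hij.symm) (one_mem _)
    rw [StarSubalgebra.mem_centralizer_iff] at this
    exact (this _ rfl).1
  have hunit (b : B) (hb : ‖b - 1‖ < 1) : IsUnit b := by
    have := isUnit_one_sub_of_norm_lt_one (x := 1 - b) (by rwa [norm_sub_rev])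
    rwa [sub_sub_cancel] at this
  have hu : IsUnit (z * s) := (hunit z (by linarith)).mul (hunit s (by linarith))
  -- An invertible isometry is unitary.
  have hs2 : z * s * star (z * s) = 1 := by
    obtain ⟨U, hU⟩ := hu
    rw [← hU] at hs1 ⊢
    rw [Units.eq_inv_of_mul_eq_one_right hs1, Units.mul_inv]
  refine ⟨⟨z * s, Unitary.mem_iff.2 ⟨hs1, hs2⟩⟩, ?_, fun i j hij => ?_⟩
  · have e : z * s - 1 = z * (s - 1) + (z - 1) := by rw [mul_sub, mul_one]; abel
    simp only
    rw [e]
    refine (norm_add_le _ _).trans ?_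
    have h1 : ‖z * (s - 1)‖ ≤ (1 + θ) * (3 * θ) := (norm_mul_le _ _).trans (by gcongr)
    nlinarith
  · simp only
    rw [mul_assoc z, ← hsv i j hij, ← mul_assoc, hint i j hij, mul_assoc _ z, mul_assoc, hs2,
      mul_one]

/-- If the members of a matrix family are close to a closed subalgebra, then a unitary close to `1`
conjugates the matrix units into it. -/
theorem exists_unitary_conj_mem (h : IsMatrixFamily v r) {ε : ℝ} (hε : 0 < ε) :
    ∃ δ > 0, ∀ E : StarSubalgebra ℂ B, IsClosed (E : Set B) → (∀ i, ∃ x ∈ E, ‖x - v i‖ < δ) →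
      ∃ u : unitary B, ‖(u : B) - 1‖ < ε ∧
        ∀ i j, r i = r j → (u : B) * (v i * star (v j)) * star (u : B) ∈ E := by
  set θ := min (ε / 8) (1 / 6)
  have hθ : 0 < θ := lt_min (by positivity) (by norm_num)
  have hN : (0 : ℝ) < Fintype.card ι + 1 := by positivity
  obtain ⟨δ, hδ, H⟩ := h.exists_partialIsometries_near (div_pos hθ hN)
  refine ⟨δ, hδ, fun E hE hx => ?_⟩
  obtain ⟨w, hwE, hw, hw', hwv⟩ := H E hE hx
  have hsum : ∑ i, ‖w i - v i‖ ≤ θ := by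
    calc ∑ i, ‖w i - v i‖ ≤ ∑ _i : ι, θ / (Fintype.card ι + 1) :=
          Finset.sum_le_sum fun i _ => (hwv i).le
      _ = Fintype.card ι * θ / (Fintype.card ι + 1) := by simp [mul_div_assoc]
      _ ≤ θ := by
        rw [div_le_iff₀ hN]
        nlinarith
  obtain ⟨u, hu, huv⟩ := h.exists_unitary hw hw' (min_le_right _ _) hsum
  refine ⟨u, hu.trans_lt ?_, fun i j hij => ?_⟩
  · have : θ ≤ ε / 8 := min_le_left _ _
    linarith
  · rw [huv i j hij]
    exact mul_mem (hwE i) (star_mem (hwE j))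

end IsMatrixFamily

/-! ### Matrix units of finite dimensional C⋆-algebras -/

/-- A nonzero projection that dominates no other nonzero projection. -/
structure IsMinimalProjection {F : Type*} [CStarAlgebra F] (p : F) : Prop where
  isStarProjection : IsStarProjection p
  ne_zero : p ≠ 0
  eq_of_mul_eq : ∀ q, IsStarProjection q → q ≠ 0 → p * q = q → q = p

section FiniteDimensional

variable {F : Type*} [CStarAlgebra F] [FiniteDimensional ℂ F]

/-- The spectrum consists of roots of the minimal polynomial. Finiteness makes every function
continuous on it, so spectral projections are available through `cfc`. -/
theorem finite_spectrum_real (a : F) : (spectrum ℝ a).Finite := by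
  rcases subsingleton_or_nontrivial F with _ | _
  · simp
  have hint := (Algebra.IsIntegral.isIntegral (R := ℂ) a)
  have h : spectrum ℂ a ⊆ (minpoly ℂ a).rootSet ℂ := fun t ht => by
    have h1 := spectrum.subset_polynomial_aeval a (minpoly ℂ a) ⟨t, ht, rfl⟩
    rw [minpoly.aeval, spectrum.zero_eq, Set.mem_singleton_iff] at h1
    exact (Polynomial.mem_rootSet_of_ne (minpoly.ne_zero hint)).2 (by simpa using h1)
  rw [← spectrum.preimage_algebraMap ℂ]
  exact ((Polynomial.rootSet_finite _ _).subset h).preimage Complex.ofReal_injective.injOn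

/-- A proper subprojection `q` of `e` spans a strictly smaller right ideal `q * F`, and subspaces of
`F` are well-founded. -/
theorem projection_induction {P : F → Prop}
    (h : ∀ e, IsStarProjection e →
      (∀ q, IsStarProjection q → e * q = q → q ≠ e → P q) → P e) :
    ∀ e, IsStarProjection e → P e := by
  have key : ∀ (V : Submodule ℂ F) (e : F), LinearMap.range (LinearMap.mulLeft ℂ e) = V →
      IsStarProjection e → P e := by
    intro V
    induction V using WellFoundedLT.induction with
    | ind V ih =>
      rintro e rfl he
      refine h e he fun q hq heq hne => ih _ (lt_of_le_of_ne ?_ ?_) q rfl hq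
      · rintro _ ⟨x, rfl⟩
        exact ⟨q * x, by simp [← mul_assoc, heq]⟩
      · intro hr
        have : e ∈ LinearMap.range (LinearMap.mulLeft ℂ q) := hr ▸ ⟨1, by simp⟩
        obtain ⟨x, hx⟩ := this
        rw [LinearMap.mulLeft_apply] at hx
        have hqe : q * e = e := by rw [← hx, ← mul_assoc, hq.isIdempotentElem.eq]
        have := congrArg star hqe
        rw [star_mul, he.isSelfAdjoint.star_eq, hq.isSelfAdjoint.star_eq, heq] at this
        exact hne this
  exact fun e he => key _ e rfl he

theorem exists_minimal_le {e : F} (he : IsStarProjection e) (h0 : e ≠ 0) :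
    ∃ p, IsMinimalProjection p ∧ e * p = p := by
  revert h0
  refine projection_induction (P := fun e => e ≠ 0 → ∃ p, IsMinimalProjection p ∧ e * p = p)
    (fun e he ih h0 => ?_) e he
  by_cases hmin : ∀ q, IsStarProjection q → q ≠ 0 → e * q = q → q = e
  · exact ⟨e, ⟨he, h0, hmin⟩, he.isIdempotentElem.eq⟩
  · push Not at hmin
    obtain ⟨q, hq, hq0, heq, hne⟩ := hmin
    obtain ⟨p, hp, hqp⟩ := ih q hq heq hne hq0
    exact ⟨p, hp, by rw [← hqp, ← mul_assoc, heq]⟩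

/-- A minimal `p` below `e` is split off, and the induction continues with `e - p`. -/
theorem exists_finset_minimal_projections : ∀ e : F, IsStarProjection e →
    ∃ T : Finset F, (∀ p ∈ T, IsMinimalProjection p) ∧
      (∀ p ∈ T, ∀ q ∈ T, p ≠ q → p * q = 0) ∧ ∑ p ∈ T, p = e := by
  classical
  refine projection_induction fun e he ih => ?_
  rcases eq_or_ne e 0 with rfl | h0
  · exact ⟨∅, by simp⟩
  obtain ⟨p, hp, hep⟩ := exists_minimal_le he h0
  have hpe : p * e = p := by
    have := congrArg star hep
    rwa [star_mul, he.isSelfAdjoint.star_eq, hp.isStarProjection.isSelfAdjoint.star_eq] at this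
  obtain ⟨T, hT1, hT2, hT3⟩ := ih (e - p) (hp.isStarProjection.sub_of_mul_eq_left he hpe)
    (by rw [mul_sub, he.isIdempotentElem.eq, hep]) (by simpa using hp.ne_zero)
  have hpT : ∀ t ∈ T, p * t = 0 := fun t ht => by
    have h1 : (e - p) * t = t := by
      rw [← hT3, Finset.sum_mul, Finset.sum_eq_single_of_mem t ht,
        (hT1 t ht).isStarProjection.isIdempotentElem.eq]
      exact fun s hs hst => hT2 s hs t ht hst
    rw [← h1, ← mul_assoc, mul_sub, hpe, hp.isStarProjection.isIdempotentElem.eq, sub_self,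
      zero_mul]
  have hTp : ∀ t ∈ T, t * p = 0 := fun t ht => by
    have := congrArg star (hpT t ht)
    rwa [star_mul, (hT1 t ht).isStarProjection.isSelfAdjoint.star_eq,
      hp.isStarProjection.isSelfAdjoint.star_eq, star_zero] at this
  have hnot : p ∉ T := fun h => hp.ne_zero (by
    rw [← hp.isStarProjection.isIdempotentElem.eq, hpT p h])
  refine ⟨insert p T, ?_, ?_, ?_⟩
  · intro q hq
    rcases Finset.mem_insert.1 hq with rfl | hq
    exacts [hp, hT1 q hq]
  · intro a ha b hb hab
    rcases Finset.mem_insert.1 ha with h1 | h1 <;> rcases Finset.mem_insert.1 hb with h2 | h2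
    exacts [absurd (h1.trans h2.symm) hab, h1 ▸ hpT b h2, h2 ▸ hTp a h1, hT2 a h1 b h2 hab]
  · rw [Finset.sum_insert hnot, hT3]
    abel

namespace IsMinimalProjection

variable {p q : F}

/-- The spectral projection of `a` at a nonzero `t` lies below `p`, so it equals `p` by minimality,
and `a = a * p = t • p`. -/
theorem exists_smul_of_isSelfAdjoint (hp : IsMinimalProjection p) {a : F} (ha : IsSelfAdjoint a)
    (hpa : p * a = a) : ∃ c : ℂ, a = c • p := by
  have hap : a * p = a := by
    have := congrArg star hpa
    rwa [star_mul, ha.star_eq, hp.isStarProjection.isSelfAdjoint.star_eq] at this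
  have hcont (f : ℝ → ℝ) : ContinuousOn f (spectrum ℝ a) := (finite_spectrum_real a).continuousOn f
  by_cases h : ∃ t ∈ spectrum ℝ a, t ≠ 0
  · obtain ⟨t, ht, ht0⟩ := h
    set f : ℝ → ℝ := fun x => if x = t then 1 else 0
    have hq : IsStarProjection (cfc f a) := ⟨by
      rw [IsIdempotentElem, ← cfc_mul f f a (hcont _) (hcont _)]
      exact cfc_congr fun x _ => by simp [f], cfc_predicate _ _⟩
    have hq0 : cfc f a ≠ 0 := fun h0 => by
      rw [← cfc_zero ℝ a] at h0
      have := eqOn_of_cfc_eq_cfc h0 (hcont _) (hcont _) ha ht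
      simp [f] at this
    have hqa : a * cfc (fun x => f x / t) a = cfc f a := by
      conv_lhs => arg 1; rw [← cfc_id ℝ a]
      rw [← cfc_mul _ _ a (hcont _) (hcont _)]
      refine cfc_congr fun x _ => ?_
      by_cases hx : x = t
      · simp [f, hx, ht0]
      · simp [f, hx]
    have hqp := hp.eq_of_mul_eq _ hq hq0 (by rw [← hqa, ← mul_assoc, hpa])
    refine ⟨t, ?_⟩
    have h1 : a * cfc f a = cfc (fun x => t • f x) a := by
      conv_lhs => arg 1; rw [← cfc_id ℝ a]
      rw [← cfc_mul _ _ a (hcont _) (hcont _)]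
      refine cfc_congr fun x _ => ?_
      by_cases hx : x = t
      · simp [f, hx]
      · simp [f, hx]
    rw [cfc_smul _ _ _ (hcont _), hqp, hap] at h1
    rw [h1, Complex.coe_smul]
  · push Not at h
    refine ⟨0, ?_⟩
    rw [zero_smul, ← cfc_id ℝ a, ← cfc_zero ℝ a]
    exact cfc_congr fun x hx => h x hx

theorem exists_smul (hp : IsMinimalProjection p) (x : F) : ∃ c : ℂ, p * x * p = c • p := by
  have hpp := hp.isStarProjection.isIdempotentElem.eq
  have hps := hp.isStarProjection.isSelfAdjoint.star_eq
  have key (y : F) (hy : IsSelfAdjoint y) : ∃ c : ℂ, p * y * p = c • p :=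
    hp.exists_smul_of_isSelfAdjoint
      (by rw [isSelfAdjoint_iff, star_mul, star_mul, hps, hy.star_eq, mul_assoc])
      (by rw [← mul_assoc, ← mul_assoc, hpp])
  obtain ⟨c, hc⟩ := key _ (realPart x).2
  obtain ⟨d, hd⟩ := key _ (imaginaryPart x).2
  refine ⟨c + Complex.I * d, ?_⟩
  conv_lhs => rw [← realPart_add_I_smul_imaginaryPart x]
  rw [mul_add, add_mul, hc, mul_smul_comm, smul_mul_assoc, hd, add_smul, mul_smul]

/-- Two minimal projections `p`, `q` with `p * F * q ≠ 0` are equivalent. -/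
theorem exists_partialIsometry (hp : IsMinimalProjection p) (hq : IsMinimalProjection q) {x : F}
    (hx : p * x * q ≠ 0) :
    ∃ w : F, p * w = w ∧ w * q = w ∧ star w * w = q ∧ w * star w = p := by
  have hpp := hp.isStarProjection.isIdempotentElem.eq
  have hps := hp.isStarProjection.isSelfAdjoint.star_eq
  have hqq := hq.isStarProjection.isIdempotentElem.eq
  have hqs := hq.isStarProjection.isSelfAdjoint.star_eq
  obtain ⟨y, hy⟩ : ∃ y, y = p * x * q := ⟨_, rfl⟩
  rw [← hy] at hx
  have hpy : p * y = y := by simp only [hy, ← mul_assoc, hpp]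
  have hyq : y * q = y := by simp only [hy, mul_assoc, hqq]
  have hqy : q * star y = star y := by rw [← hqs, ← star_mul, hyq]
  obtain ⟨c, hc⟩ := hq.exists_smul (star y * y)
  have hc : star y * y = c • q := by
    rw [← hc, ← mul_assoc, hqy, mul_assoc, hyq]
  have hre : c.re = c := by
    have h1 := congrArg star hc
    rw [star_mul, star_star, star_smul, hqs, hc] at h1
    exact (Complex.conj_eq_iff_re.1 (smul_left_injective ℂ hq.ne_zero h1).symm)
  -- As `c` is an eigenvalue of `star y * y`, positivity of the latter gives `0 ≤ c`, and rescaling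
  -- `y` by `1 / √c` gives `w`.
  have hmem : c.re ∈ spectrum ℝ (star y * y) := by
    rw [spectrum.mem_iff, hc, ← hre, Complex.ofReal_re, Complex.coe_smul,
      Algebra.algebraMap_eq_smul_one, ← smul_sub]
    rintro ⟨U, hU⟩
    have : (U : F) * q = 0 := by
      rw [hU, smul_mul_assoc, sub_mul, one_mul, hqq, sub_self, smul_zero]
    exact hq.ne_zero (by simpa using this)
  have hpos : 0 < c.re := by
    refine lt_of_le_of_ne (spectrum_star_mul_self_nonneg _ hmem) fun h0 => hx ?_
    rw [← hre, ← h0, Complex.ofReal_zero, zero_smul] at hc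
    exact CStarRing.star_mul_self_eq_zero_iff _ |>.1 hc
  set w := ((√c.re)⁻¹ : ℝ) • y
  have hw : star w * w = q := by
    rw [star_smul, star_trivial, smul_mul_smul_comm, hc, ← hre, Complex.ofReal_re, Complex.coe_smul,
      smul_smul, ← mul_inv, Real.mul_self_sqrt hpos.le, inv_mul_cancel₀ hpos.ne', one_smul]
  have hpw : p * w = w := by rw [mul_smul_comm, hpy]
  have hwq : w * q = w := by rw [smul_mul_assoc, hyq]
  refine ⟨w, hpw, hwq, hw, hp.eq_of_mul_eq _ ⟨?_, IsSelfAdjoint.mul_star_self w⟩ ?_ ?_⟩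
  · rw [IsIdempotentElem, ← mul_assoc, mul_assoc w, hw, hwq]
  · intro h0
    rw [CStarRing.mul_star_self_eq_zero_iff] at h0
    rw [h0, mul_zero] at hw
    exact hq.ne_zero hw.symm
  · rw [← mul_assoc, hpw]

end IsMinimalProjection

/-- A finite dimensional C⋆-algebra is spanned by the matrix units of a matrix family. -/
theorem exists_isMatrixFamily_span (F : Type u) [CStarAlgebra F] [FiniteDimensional ℂ F] :
    ∃ (ι : Type u) (_ : Fintype ι) (v : ι → F) (r : ι → ι), IsMatrixFamily v r ∧
      ∀ x : F, x ∈ Submodule.span ℂ {y | ∃ i j, r i = r j ∧ y = v i * star (v j)} := by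
  classical
  obtain ⟨T, hT, hTT, hT1⟩ := exists_finset_minimal_projections (1 : F) (IsStarProjection.one F)
  have hsum : ∑ i : T, (i : F) = 1 := by rw [← hT1, ← Finset.sum_coe_sort T fun p => p]
  have hi (i : T) : (i : F) * i = i := (hT i i.2).isStarProjection.isIdempotentElem.eq
  have his (i : T) : star (i : F) = i := (hT i i.2).isStarProjection.isSelfAdjoint.star_eq
  -- Murray–von Neumann equivalence; `r` picks a representative of each class and `v i` links `i` to
  -- it.
  let R : T → T → Prop := fun i j => ∃ w : F, (i : F) * w = w ∧ w * j = w ∧ star w * w = j ∧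
    w * star w = i
  let S : Setoid T :=
    { r := R
      iseqv :=
        { refl := fun i => ⟨i, hi i, hi i, by rw [his, hi], by rw [his, hi]⟩
          symm := fun {i j} ⟨w, h1, h2, h3, h4⟩ => ⟨star w, by rw [← his j, ← star_mul, h2],
            by rw [← his i, ← star_mul, h1], by rw [star_star, h4], by rw [star_star, h3]⟩
          trans := fun {i j k} ⟨w, h1, h2, h3, h4⟩ ⟨z, k1, k2, k3, k4⟩ => ⟨w * z,
            by rw [← mul_assoc, h1], by rw [mul_assoc, k2],
            by rw [star_mul, mul_assoc, ← mul_assoc (star w), h3, k1, k3],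
            by rw [star_mul, mul_assoc, ← mul_assoc z, k4, ← mul_assoc, h2, h4]⟩ } }
  let r : T → T := fun i => (Quotient.mk S i).out
  have hr (i : T) : R i (r i) := S.symm (Quotient.mk_out (s := S) i)
  choose v hv1 hv2 hv3 hv4 using hr
  have hort (i j : T) (hij : i ≠ j) : (i : F) * j = 0 :=
    hTT i i.2 j j.2 fun h => hij (Subtype.ext h)
  have hv5 (i : T) : star (v i) * i = star (v i) := by
    rw [← his i, ← star_mul, hv1]
  refine ⟨T, inferInstance, v, r, ⟨fun i j hij => ?_, fun i => ?_, fun i => ?_, ?_⟩, fun x => ?_⟩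
  · rw [← hv5 i, ← hv1 j, mul_assoc, ← mul_assoc (i : F), hort i j hij, zero_mul, mul_zero]
  · rw [hv3, hv4]
  · rw [hv3, hv2]
  · simp only [hv4, hsum]
  · have hx : x = ∑ i : T, ∑ j : T, (i : F) * x * j := by
      simp only [← Finset.mul_sum, ← Finset.sum_mul, hsum, one_mul, mul_one]
    rw [hx]
    refine sum_mem fun i _ => sum_mem fun j _ => ?_
    -- A nonzero block forces `i` and `j` to be equivalent; transported to the corner of `r i`, it
    -- becomes a scalar.
    by_cases h0 : (i : F) * x * j = 0
    · rw [h0]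
      exact zero_mem _
    have hij : r i = r j := congrArg Quotient.out (Quotient.sound (s := S)
      ((hT i i.2).exists_partialIsometry (hT j j.2) h0))
    obtain ⟨c, hc⟩ := (hT (r i) (r i).2).exists_smul (star (v i) * x * v j)
    have h1 : (i : F) * x * j = c • (v i * star (v j)) := by
      calc (i : F) * x * j = v i * star (v i) * x * (v j * star (v j)) := by rw [hv4, hv4]
        _ = v i * (star (v i) * x * v j) * star (v j) := by simp only [mul_assoc]
        _ = v i * (r i * (star (v i) * x * v j) * r i) * star (v j) := by
          have h2 : (r i : F) * star (v j) = star (v j) := by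
            rw [hij, ← his (r j), ← star_mul, hv2]
          simp only [mul_assoc, h2]
          rw [← mul_assoc (v i) (r i : F), hv2]
        _ = _ := by rw [hc, mul_smul_comm, smul_mul_assoc, hv2]
    rw [h1]
    exact Submodule.smul_mem _ _ (Submodule.subset_span ⟨i, j, hij, rfl⟩)

end FiniteDimensional

/-! ### Local approximation and the AF property -/

theorem StarSubalgebra.isClosed_of_finiteDimensional {B : Type*} [CStarAlgebra B]
    (F : StarSubalgebra ℂ B) [hF : FiniteDimensional ℂ F] : IsClosed (F : Set B) :=
  have : FiniteDimensional ℂ (Subalgebra.toSubmodule F.toSubalgebra) := hF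
  (Subalgebra.toSubmodule F.toSubalgebra).closed_of_finiteDimensional

theorem StarSubalgebra.finiteDimensional_map {A B : Type*} [CStarAlgebra A] [CStarAlgebra B]
    (f : A →⋆ₐ[ℂ] B) (F : StarSubalgebra ℂ A) [hF : FiniteDimensional ℂ F] :
    FiniteDimensional ℂ (F.map f) := by
  have : FiniteDimensional ℂ (Subalgebra.toSubmodule F.toSubalgebra) := hF
  have : FiniteDimensional ℂ
      ((Subalgebra.toSubmodule F.toSubalgebra).map f.toAlgHom.toLinearMap) := inferInstance
  exact this

/-- Finite sets are approximated by finite dimensional unital subalgebras. -/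
def IsLocallyFiniteDimensional (B : Type*) [CStarAlgebra B] : Prop :=
  ∀ (S : Finset B) (ε : ℝ), 0 < ε → ∃ F : StarSubalgebra ℂ B, FiniteDimensional ℂ F ∧
    ∀ s ∈ S, ∃ x ∈ F, ‖x - s‖ < ε

theorem norm_conj_sub_le {B : Type*} [CStarAlgebra B] (u : unitary B) (x s : B) :
    ‖star (u : B) * x * u - s‖ ≤ ‖x - s‖ + 2 * ‖(u : B) - 1‖ * ‖s‖ := by
  have e : star (u : B) * x * u - s =
      star (u : B) * ((x - s) * u + (s * ((u : B) - 1) + -(((u : B) - 1) * s))) := by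
    have h1 : (x - s) * (u : B) + (s * ((u : B) - 1) + -(((u : B) - 1) * s)) = x * u - u * s := by
      noncomm_ring
    rw [h1, mul_sub, ← mul_assoc, ← mul_assoc, Unitary.coe_star_mul_self, one_mul]
  rw [e, ← Unitary.coe_star, CStarRing.norm_coe_unitary_mul]
  refine (norm_add_le _ _).trans ?_
  rw [CStarRing.norm_mul_coe_unitary]
  have h1 := norm_add_le (s * ((u : B) - 1)) (-(((u : B) - 1) * s))
  rw [norm_neg] at h1
  linarith [norm_mul_le s ((u : B) - 1), norm_mul_le ((u : B) - 1) s]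

/-- `E` is chosen to approximate both `S` and the matrix family of `F`. A unitary `u` near `1`
conjugates the matrix units of `F` into `E`, so `star u * E * u` contains `F` and still approximates
`S`. -/
theorem IsLocallyFiniteDimensional.exists_ge {B : Type*} [CStarAlgebra B]
    (hB : IsLocallyFiniteDimensional B) (F : StarSubalgebra ℂ B) [FiniteDimensional ℂ F]
    (S : Finset B) {ε : ℝ} (hε : 0 < ε) :
    ∃ F' : StarSubalgebra ℂ B, FiniteDimensional ℂ F' ∧ F ≤ F' ∧
      ∀ s ∈ S, ∃ x ∈ F', ‖x - s‖ < ε := by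
  classical
  have : IsClosed (F : Set B) := F.isClosed_of_finiteDimensional
  obtain ⟨ι, _, v, r, hv, hspan⟩ := exists_isMatrixFamily_span F
  have hv' : IsMatrixFamily (fun i => (v i : B)) r :=
    ⟨fun i j hij => congrArg Subtype.val (hv.ortho i j hij),
      fun i => congrArg Subtype.val (hv.source i), fun i => congrArg Subtype.val (hv.isometry i), by
        have := congrArg F.subtype hv.sum_range
        rw [map_sum, map_one] at this
        exact this⟩
  set M := ∑ s ∈ S, ‖s‖
  have hM : 0 ≤ M := Finset.sum_nonneg fun _ _ => norm_nonneg _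
  -- Conjugation moves `s` by at most `2 * ‖u - 1‖ * ‖s‖`, which must stay below `ε / 2`.
  obtain ⟨δ, hδ, H⟩ := hv'.exists_unitary_conj_mem (div_pos hε (by positivity : 0 < 4 * (M + 1)))
  obtain ⟨E, hE, hES⟩ := hB (S ∪ Finset.univ.image fun i => (v i : B)) (min δ (ε / 2))
    (lt_min hδ (by positivity))
  obtain ⟨u, hu, huE⟩ := H E E.isClosed_of_finiteDimensional fun i => by
    obtain ⟨x, hx, hxv⟩ := hES (v i) (by simp)
    exact ⟨x, hx, hxv.trans_le (min_le_left _ _)⟩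
  set f : B →⋆ₐ[ℂ] B := StarAlgEquiv.toStarAlgHom (Unitary.conjStarAlgAut ℂ B (star u))
  have hf (x : B) : f x = star (u : B) * x * u := Unitary.conjStarAlgAut_star_apply (S := ℂ) u x
  have hmem (y : B) (hy : (u : B) * y * star (u : B) ∈ E) : y ∈ E.map f := by
    refine StarSubalgebra.mem_map.2 ⟨_, hy, ?_⟩
    rw [hf]
    simp only [mul_assoc, Unitary.coe_star_mul_self, mul_one]
    rw [← mul_assoc, Unitary.coe_star_mul_self, one_mul]
  refine ⟨E.map f, E.finiteDimensional_map f, fun x hx => ?_, fun s hs => ?_⟩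
  · have h1 : ∀ y : F, (y : B) ∈ E.map f := fun y => by
      induction hspan y using Submodule.span_induction with
      | mem y hy =>
        obtain ⟨i, j, hij, rfl⟩ := hy
        exact hmem _ (huE i j hij)
      | zero => exact zero_mem _
      | add a b _ _ ha hb => exact add_mem ha hb
      | smul c a _ ha => exact SMulMemClass.smul_mem c ha
    exact h1 ⟨x, hx⟩
  · obtain ⟨x, hx, hxs⟩ := hES s (Finset.mem_union_left _ hs)
    refine ⟨f x, StarSubalgebra.mem_map.2 ⟨x, hx, rfl⟩, ?_⟩
    rw [hf]
    refine (norm_conj_sub_le u x s).trans_lt ?_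
    have h1 : ‖x - s‖ < ε / 2 := hxs.trans_le (min_le_right _ _)
    have h2 : ‖s‖ ≤ M := Finset.single_le_sum (f := fun s : B => ‖s‖) (fun _ _ => norm_nonneg _) hs
    rw [lt_div_iff₀ (by positivity)] at hu
    nlinarith [norm_nonneg ((u : B) - 1), norm_nonneg s]

/-- Stage `n + 1` contains stage `n` and approximates the terms `0, …, n` of a dense sequence to
within `1 / (n + 1)`. -/
theorem IsLocallyFiniteDimensional.isAFAlgebra {B : Type*} [CStarAlgebra B]
    [TopologicalSpace.SeparableSpace B] (hB : IsLocallyFiniteDimensional B) : IsAFAlgebra B := by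
  classical
  choose next hn1 hn2 hn3 using fun (F : {F : StarSubalgebra ℂ B // FiniteDimensional ℂ F})
      (n : ℕ) =>
    have := F.2
    hB.exists_ge F.1 ((Finset.range (n + 1)).image (TopologicalSpace.denseSeq B))
      (Nat.one_div_pos_of_nat (α := ℝ) (n := n))
  obtain ⟨F0, hF0, -⟩ := hB ∅ 1 one_pos
  let G : ℕ → {F : StarSubalgebra ℂ B // FiniteDimensional ℂ F} := fun n =>
    Nat.rec ⟨F0, hF0⟩ (fun n F => ⟨next F n, hn1 F n⟩) n
  have hG (n : ℕ) : (G (n + 1)).1 = next (G n) n := rfl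
  refine ⟨fun n => (G n).1.toNonUnitalStarSubalgebra, monotone_nat_of_le_succ fun n => ?_,
    fun n => (G n).2, ?_⟩
  · exact fun x hx => hn2 (G n) n hx
  · rw [Metric.dense_iff]
    intro x ε hε
    obtain ⟨k, hk⟩ := (TopologicalSpace.denseRange_denseSeq B).exists_dist_lt x (half_pos hε)
    obtain ⟨m, hm⟩ := exists_nat_one_div_lt (half_pos hε)
    obtain ⟨y, hy, hyk⟩ := hn3 (G (max k m)) (max k m) (TopologicalSpace.denseSeq B k)
      (Finset.mem_image_of_mem _ (Finset.mem_range.2 (by omega)))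
    refine ⟨y, ?_, Set.mem_iUnion.2 ⟨max k m + 1, hy⟩⟩
    rw [Metric.mem_ball, dist_comm]
    refine (dist_triangle x (TopologicalSpace.denseSeq B k) y).trans_lt ?_
    have h1 : (1 : ℝ) / ((max k m : ℕ) + 1) ≤ 1 / (m + 1) := by
      gcongr
      exact le_max_right _ _
    rw [dist_comm _ y, dist_eq_norm y]
    linarith

/-- A finite dimensional subalgebra stays finite dimensional when the unit is added. -/
theorem NonUnitalStarSubalgebra.exists_unital_ge {B : Type*} [CStarAlgebra B]
    (D : NonUnitalStarSubalgebra ℂ B) [FiniteDimensional ℂ D] :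
    ∃ F : StarSubalgebra ℂ B, FiniteDimensional ℂ F ∧ ∀ x ∈ D, x ∈ F := by
  refine ⟨StarAlgebra.adjoin ℂ (D : Set B), ?_, fun x hx => StarAlgebra.subset_adjoin ℂ _ hx⟩
  rw [← NonUnitalStarSubalgebra.unitization_range]
  have : FiniteDimensional ℂ (Unitization ℂ D) := 
    Module.Finite.equiv (Unitization.linearEquiv ℂ ℂ D).symm
  exact inferInstanceAs (FiniteDimensional ℂ
    (LinearMap.range (NonUnitalStarSubalgebra.unitization D).toAlgHom.toLinearMap))

/-- By monotonicity one stage serves all of `S`; its unit may differ from that of `A`, so `1` is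
adjoined. -/
theorem IsAFAlgebra.isLocallyFiniteDimensional {A : Type*} [CStarAlgebra A] (hA : IsAFAlgebra A) :
    IsLocallyFiniteDimensional A := by
  obtain ⟨F, hF, hfd, hd⟩ := hA
  intro S ε hε
  have h (s : A) : ∃ n, ∃ x ∈ F n, ‖x - s‖ < ε := by
    obtain ⟨x, hx, hxs⟩ := Metric.dense_iff.1 hd s ε hε
    obtain ⟨n, hn⟩ := Set.mem_iUnion.1 hxs
    exact ⟨n, x, hn, by rwa [Metric.mem_ball, dist_eq_norm] at hx⟩
  choose n hn using h
  have := hfd (S.sup n)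
  obtain ⟨E, hE, hFE⟩ := (F (S.sup n)).exists_unital_ge
  refine ⟨E, hE, fun s hs => ?_⟩
  obtain ⟨x, hx, hxs⟩ := hn s
  exact ⟨x, hFE x (hF (Finset.le_sup hs) hx), hxs⟩

theorem IsAFAlgebra.separableSpace {A : Type*} [CStarAlgebra A] (hA : IsAFAlgebra A) :
    TopologicalSpace.SeparableSpace A := by
  obtain ⟨F, -, hfd, hd⟩ := hA
  have h (n : ℕ) : TopologicalSpace.IsSeparable (F n : Set A) := by
    have := hfd n
    have : TopologicalSpace.SeparableSpace (F n) :=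
      by
      have := FiniteDimensional.proper ℂ (F n)
      infer_instance
    exact TopologicalSpace.IsSeparable.of_subtype _
  have := (TopologicalSpace.IsSeparable.iUnion h).closure
  rw [hd.closure_eq] at this
  exact TopologicalSpace.isSeparable_univ_iff.1 this

/-! ### Matrix-like subalgebras from partial isometries -/

/-- The algebra spanned by the elements `w i * b * star (w j)`, for partial isometries `w i` with
orthogonal ranges and common source `p`, and `b` in a subalgebra containing `p`. -/
theorem exists_subalgebra_of_partialIsometries {B κ : Type*} [CStarAlgebra B] [Fintype κ]
    (C : StarSubalgebra ℂ B) [FiniteDimensional ℂ C] {p : B} (hp : p ∈ C) {w : κ → B}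
    (hw : ∀ i, star (w i) * w i = p) (hw0 : ∀ i j, i ≠ j → star (w i) * w j = 0) :
    ∃ D : NonUnitalStarSubalgebra ℂ B, FiniteDimensional ℂ D ∧
      ∀ i j, ∀ b ∈ C, w i * b * star (w j) ∈ D := by
  classical
  let Φ : (κ → κ → C) →ₗ[ℂ] B :=
    { toFun := fun M => ∑ i, ∑ j, w i * M i j * star (w j)
      map_add' := fun M N => by
        simp [mul_add, add_mul, Finset.sum_add_distrib]
      map_smul' := fun c M => by
        simp [Finset.smul_sum] }
  have hΦ (M : κ → κ → C) : Φ M = ∑ i, ∑ j, w i * M i j * star (w j) := rfl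
  let D : NonUnitalStarSubalgebra ℂ B :=
    { LinearMap.range Φ with
      mul_mem' := by
        rintro _ _ ⟨M, rfl⟩ ⟨N, rfl⟩
        -- Since `star (w l) * w k` is `p` for `l = k` and `0` otherwise, products are matrix
        -- products with `p` inserted; this is where `p ∈ C` enters.
        refine ⟨fun i j => ∑ k, M i k * ⟨p, hp⟩ * N k j, ?_⟩
        simp only [hΦ, Finset.sum_mul, Finset.mul_sum, AddSubmonoidClass.coe_finsetSum,
          MulMemClass.coe_mul]
        have h (k j i : κ) : ∑ l, w i * (M i l : B) * star (w l) * (w k * N k j * star (w j)) =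
            w i * (M i k * p * N k j) * star (w j) := by
          rw [Finset.sum_eq_single k, ← hw k]
          · simp only [mul_assoc]
          · intro l _ hl
            rw [mul_assoc (w k), mul_assoc, ← mul_assoc (star (w l)), hw0 l k hl, zero_mul,
              mul_zero]
          · simp
        simp only [h]
        rw [Finset.sum_comm' (t' := Finset.univ) (s' := fun _ => Finset.univ) (by simp)]
        exact (Finset.sum_congr rfl fun j _ => Finset.sum_comm.trans
          (Finset.sum_congr rfl fun k _ => rfl)).trans Finset.sum_comm
      star_mem' := by
        rintro _ ⟨M, rfl⟩
        refine ⟨fun i j => star (M j i), ?_⟩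
        simp only [hΦ, star_sum, star_mul, star_star, StarMemClass.coe_star, mul_assoc]
        exact Finset.sum_comm }
  refine ⟨D, inferInstanceAs (FiniteDimensional ℂ (LinearMap.range Φ)), fun i j b hb => ?_⟩
  refine ⟨Pi.single i (Pi.single j ⟨b, hb⟩), ?_⟩
  rw [hΦ, Finset.sum_eq_single i, Finset.sum_eq_single j]
  · simp
  · intro k _ hk
    simp [hk]
  · simp
  · intro k _ hk
    simp [hk]
  · simp

/-! ### The canonical covariant homomorphism -/

namespace CrossedProduct

variable {A : Type u} [CStarAlgebra A] {G : Type v} [Group G] [Fintype G]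
  {α : G →* (A ≃⋆ₐ[ℂ] A)}

open Classical in
/-- The element `a * u g` of the crossed product. -/
noncomputable def single (α : G →* (A ≃⋆ₐ[ℂ] A)) (g : G) (a : A) : CrossedProduct α :=
  ⟨Pi.single g a⟩

theorem integrate_single (ρ : CovariantHom α) (g : G) (a : A) :
    ρ.integrate (single α g a) = ρ.π a * (ρ.u g : ρ.B) := by
  classical
  rw [CovariantHom.integrate, Finset.sum_eq_single g]
  · simp [single]
  · intro h _ hh
    simp [single, hh]
  · simp

/-- The canonical covariant homomorphism to the crossed product. -/
noncomputable def universalHom (α : G →* (A ≃⋆ₐ[ℂ] A)) : CovariantHom α where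
  B := CrossedProduct α
  π :=
    { toFun := single α 1
      map_one' := regular_injective (by
        simp [integrate_single, CovariantHom.integrate_one])
      map_mul' := fun a b => regular_injective (by
        simp [integrate_single, CovariantHom.integrate_mul])
      map_zero' := regular_injective (by
        simp [integrate_single, CovariantHom.integrate_zero])
      map_add' := fun a b => regular_injective (by
        simp [integrate_single, CovariantHom.integrate_add])
      commutes' := fun c => regular_injective (by
        simp [integrate_single, Algebra.algebraMap_eq_smul_one, CovariantHom.integrate_smul,
          CovariantHom.integrate_one])
      map_star' := fun a => regular_injective (by
        simp [integrate_single, CovariantHom.integrate_star, map_star]) }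
  u :=
    { toFun := fun g => ⟨single α g 1, Unitary.mem_iff.2
        ⟨regular_injective (by
          simp [integrate_single, CovariantHom.integrate_mul, CovariantHom.integrate_star,
            CovariantHom.integrate_one]),
        regular_injective (by
          simp [integrate_single, CovariantHom.integrate_mul, CovariantHom.integrate_star,
            CovariantHom.integrate_one])⟩⟩
      map_one' := Subtype.ext (regular_injective (by
        simp [integrate_single, CovariantHom.integrate_one]))
      map_mul' := fun g h => Subtype.ext (regular_injective (by
        simp [integrate_single, CovariantHom.integrate_mul])) }
  covariant g a := regular_injective (by
    have h := (regular α).covariant g a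
    simpa [integrate_single, CovariantHom.integrate_mul, CovariantHom.integrate_star] using h)

/-- Approximations in the target of an arbitrary covariant homomorphism thereby become
approximations in the crossed product. -/
theorem universalHom_integrate (x : CrossedProduct α) : (universalHom α).integrate x = x := by
  have h (g : G) (a : A) : (universalHom α).π a * ((universalHom α).u g : (universalHom α).B) =
      single α g a := regular_injective (by
    show (regular α).integrate (single α 1 a * single α g 1) = _
    simp [integrate_single, CovariantHom.integrate_mul])
  simp only [CovariantHom.integrate, h]
  classical
  apply (coeffCLE α).injective
  refine (map_sum (coeffCLE α) (fun g => single α g (x.coeff g)) Finset.univ).trans ?_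
  exact Finset.univ_sum_single x.coeff

end CrossedProduct

/-! ### Approximation in the crossed product by the Rokhlin property -/

namespace CrossedProduct

variable {A : Type u} [CStarAlgebra A] {G : Type v} [Group G] [Fintype G]
  {α : G →* (A ≃⋆ₐ[ℂ] A)}

theorem norm_triple_sub_le {B : Type*} [CStarAlgebra B] {w w' f f' b a : B} {η M : ℝ}
    (hw' : ‖w'‖ ≤ 1) (hf : ‖f‖ ≤ 1) (hwf : ‖w - f‖ ≤ 4 * η) (hwf' : ‖w' - f'‖ ≤ 4 * η)
    (hba : ‖b - a‖ ≤ η) (hb : ‖b‖ ≤ M + 1) (ha : ‖a‖ ≤ M) :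
    ‖w * b * star w' - f * a * star f'‖ ≤ (8 * M + 5) * η := by
  have hη : 0 ≤ η := (norm_nonneg _).trans hba
  have hM : 0 ≤ M := (norm_nonneg _).trans ha
  have e : w * b * star w' - f * a * star f' =
      (w - f) * b * star w' + f * (b - a) * star w' + f * a * star (w' - f') := by
    rw [star_sub]
    noncomm_ring
  rw [e]
  refine norm_add₃_le.trans ?_
  have h1 : ‖(w - f) * b * star w'‖ ≤ 4 * η * (M + 1) * 1 :=
    norm_mul₃_le.trans (by rw [norm_star]; gcongr)
  have h2 : ‖f * (b - a) * star w'‖ ≤ 1 * η * 1 :=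
    norm_mul₃_le.trans (by rw [norm_star]; gcongr)
  have h3 : ‖f * a * star (w' - f')‖ ≤ 1 * M * (4 * η) :=
    norm_mul₃_le.trans (by rw [norm_star]; gcongr)
  linarith

/-- The main estimate: the Rokhlin projections give partial isometries `w g` close to
`e g * u g` with common source close to `e 1`. -/
theorem exists_rokhlin_partialIsometries (ρ : CovariantHom α) {e : G → A} {η : ℝ} (hη : η ≤ 1 / 4)
    (he : ∀ g, IsStarProjection (e g)) (hee : ∀ g h, g ≠ h → e g * e h = 0)
    (hα : ∀ g h, ‖α g (e h) - e (g * h)‖ ≤ η) {p : A} (hp : IsStarProjection p)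
    (hpe : ‖p - e 1‖ ≤ η) :
    ∃ w : G → ρ.B, (∀ g, star (w g) * w g = ρ.π p) ∧
      (∀ g h, g ≠ h → star (w g) * w h = 0) ∧
      ∀ g, ‖w g - ρ.π (e g) * (ρ.u g : ρ.B)‖ ≤ 4 * η := by
  -- The factor `p` on the right lets the polar part have source exactly `p`, for all `g` at once.
  set y : G → ρ.B := fun g => ρ.π (e g) * (ρ.u g : ρ.B) * ρ.π p
  have hπ (a : A) : ‖ρ.π a‖ ≤ ‖a‖ := NonUnitalStarAlgHom.norm_apply_le ρ.π a
  have hπe (g : G) : ρ.π (e g) * ρ.π (e g) = ρ.π (e g) := by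
    rw [← map_mul, (he g).isIdempotentElem.eq]
  have hπs (g : G) : star (ρ.π (e g)) = ρ.π (e g) := by
    rw [← map_star, (he g).isSelfAdjoint.star_eq]
  have hη0 : 0 ≤ η := (norm_nonneg _).trans hpe
  have hP : IsStarProjection (ρ.π p) := hp.map ρ.π
  have hyn (g : G) : ‖y g‖ ≤ 1 := by
    have h1 : ‖ρ.π (e g) * (ρ.u g : ρ.B)‖ ≤ 1 := by
      rw [CStarRing.norm_mul_coe_unitary]
      exact IsStarProjection.norm_le _ ((he g).map ρ.π)
    calc ‖y g‖ ≤ 1 * 1 := (norm_mul_le _ _).trans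
          (mul_le_mul h1 (IsStarProjection.norm_le _ hP) (norm_nonneg _) zero_le_one)
      _ = 1 := one_mul 1
  have hyP (g : G) : y g * ρ.π p = y g := by
    rw [mul_assoc, hP.isIdempotentElem.eq]
  have hyy (g : G) : star (y g) * y g = ρ.π (p * α g⁻¹ (e g) * p) := by
    have h1 : ρ.π (e g) * (ρ.u g : ρ.B) = (ρ.u g : ρ.B) * ρ.π (α g⁻¹ (e g)) := by
      rw [ρ.u_mul_π, ← StarAlgEquiv.mul_apply, ← map_mul, mul_inv_cancel, map_one]
      rfl
    calc star (y g) * y g = ρ.π p * star (ρ.u g : ρ.B) * (ρ.π (e g) * ρ.π (e g)) *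
          (ρ.u g : ρ.B) * ρ.π p := by
          simp only [y, star_mul, hπs, hP.isSelfAdjoint.star_eq, mul_assoc]
      _ = ρ.π p * star (ρ.u g : ρ.B) * (ρ.π (e g) * (ρ.u g : ρ.B)) * ρ.π p := by
          rw [hπe]; simp only [mul_assoc]
      _ = ρ.π p * (star (ρ.u g : ρ.B) * (ρ.u g : ρ.B)) * ρ.π (α g⁻¹ (e g)) * ρ.π p := by
          rw [h1]; simp only [mul_assoc]
      _ = _ := by rw [Unitary.coe_star_mul_self, mul_one, map_mul, map_mul]
  -- `α g⁻¹ (e g)` is near `e 1`, hence near `p`; the bound `2 * η ≤ 1 / 2` for the polar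
  -- decomposition is the reason for `η ≤ 1 / 4`.
  have hsmall (g : G) : ‖star (y g) * y g - ρ.π p‖ ≤ 2 * η := by
    have h1 : p * α g⁻¹ (e g) * p - p = p * (α g⁻¹ (e g) - p) * p := by
      rw [mul_sub, sub_mul, hp.isIdempotentElem.eq, hp.isIdempotentElem.eq]
    have h2 : ‖α g⁻¹ (e g) - p‖ ≤ 2 * η := by
      have h3 := hα g⁻¹ g
      rw [inv_mul_cancel] at h3
      have h4 := norm_sub_le_norm_sub_add_norm_sub (α g⁻¹ (e g)) (e 1) p
      rw [norm_sub_rev (e 1)] at h4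
      linarith
    rw [hyy, ← map_sub, h1]
    refine (hπ _).trans (norm_mul₃_le.trans ?_)
    have h5 := IsStarProjection.norm_le _ hp
    calc _ ≤ 1 * (2 * η) * 1 := by gcongr
      _ = 2 * η := by ring
  choose s hs1 hs2 hs3 hs4 using fun g =>
    exists_polar hP (hyP g) (by linarith : 2 * η ≤ 1 / 2) (hsmall g)
  refine ⟨fun g => y g * s g, hs1, fun g h hgh => ?_, fun g => ?_⟩
  · have e0 : star (y g) * y h = 0 := by
      have h1 : ρ.π (e g) * ρ.π (e h) = 0 := by rw [← map_mul, hee g h hgh, map_zero]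
      simp only [y, star_mul, hπs, mul_assoc]
      rw [← mul_assoc (ρ.π (e g)), h1]
      simp
    rw [star_mul, mul_assoc, ← mul_assoc (star (y g)), e0, zero_mul, mul_zero]
  · have e1 : y g - ρ.π (e g) * (ρ.u g : ρ.B) =
        -(ρ.π (e g * (e g - α g p)) * (ρ.u g : ρ.B)) := by
      rw [mul_sub, (he g).isIdempotentElem.eq, map_sub, sub_mul, neg_sub, map_mul, mul_assoc _ _
        (ρ.u g : ρ.B), ← ρ.u_mul_π, ← mul_assoc]
    have h2 : ‖e g - α g p‖ ≤ 2 * η := by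
      have h3 := hα g 1
      rw [mul_one, norm_sub_rev] at h3
      have h4 := norm_sub_le_norm_sub_add_norm_sub (e g) (α g (e 1)) (α g p)
      rw [← map_sub, StarAlgEquiv.norm_map, norm_sub_rev (e 1)] at h4
      linarith
    have h3 : ‖y g - ρ.π (e g) * (ρ.u g : ρ.B)‖ ≤ 1 * (2 * η) := by
      rw [e1, norm_neg, CStarRing.norm_mul_coe_unitary]
      refine (hπ _).trans ((norm_mul_le _ _).trans ?_)
      gcongr
      exact IsStarProjection.norm_le _ (he g)
    have e2 : y g * s g - ρ.π (e g) * (ρ.u g : ρ.B) =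
        y g * (s g - 1) + (y g - ρ.π (e g) * (ρ.u g : ρ.B)) := by
      rw [mul_sub, mul_one]; abel
    have h4 : ‖y g * (s g - 1)‖ ≤ 1 * (2 * η) :=
      (norm_mul_le _ _).trans (mul_le_mul (hyn g) (hs3 g) (norm_nonneg _) zero_le_one)
    simp only
    rw [e2]
    linarith [norm_add_le (y g * (s g - 1)) (y g - ρ.π (e g) * (ρ.u g : ρ.B))]

/-- For `h = k⁻¹ * g`, covariance turns `(e g * u g) * α g⁻¹ a * star (e h * u h)` into `e g * a * α
k (e h) * u k`. Here `α k (e h) ≈ e g`, and `e g` nearly commutes with `a`, so this is close to `e g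
* a * u k`; these sum to `a * u k`. -/
theorem exists_finiteDimensional_near (hA : IsLocallyFiniteDimensional A)
    (hα : HasStrictRokhlinProperty α) (ρ : CovariantHom α) (T : Finset A) {ε : ℝ} (hε : 0 < ε) :
    ∃ D : NonUnitalStarSubalgebra ℂ ρ.B, FiniteDimensional ℂ D ∧
      ∀ a ∈ T, ∀ k, ∃ d ∈ D, ‖d - ρ.π a * (ρ.u k : ρ.B)‖ < ε := by
  classical
  set M := ∑ a ∈ T, ‖a‖
  have hM : 0 ≤ M := Finset.sum_nonneg fun _ _ => norm_nonneg _
  set n : ℝ := (Fintype.card G : ℝ)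
  have hn : 0 ≤ n := Nat.cast_nonneg _
  -- Each of the `n` summands has error at most `(8 * M + 5) * η + (M + 1) * η`.
  set η := min (1 / 4) (ε / ((n + 1) * (9 * M + 6)))
  have hη : 0 < η := lt_min (by norm_num) (by positivity)
  have hη1 : η ≤ 1 / 4 := min_le_left _ _
  have hηε : n * ((9 * M + 6) * η) < ε := by
    have h1 : η * ((n + 1) * (9 * M + 6)) ≤ ε :=
      (le_div_iff₀ (by positivity)).1 (min_le_right _ _)
    have h2 : 0 < (9 * M + 6) * η := by positivity
    linarith
  obtain ⟨e, he, hee, hαe, hcomm, hsum⟩ := hα T η hη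
  obtain ⟨δ, hδ, H⟩ := exists_projections_near he hee hsum hη
  obtain ⟨E, hE, hES⟩ := hA (Finset.univ.image e ∪
    (Finset.univ ×ˢ T).image fun x : G × A => α x.1⁻¹ x.2) (min δ η) (lt_min hδ hη)
  -- Only `q 1`, the common source, is used later; orthogonality of the ranges comes from the `e g`,
  -- which need not lie in `E`.
  obtain ⟨q, hqE, hq, -, hqe⟩ := H E E.isClosed_of_finiteDimensional fun g => by
    obtain ⟨x, hx, hxe⟩ := hES (e g) (by simp)
    exact ⟨x, hx, hxe.trans_le (min_le_left _ _)⟩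
  obtain ⟨w, hw, hw0, hwf⟩ := exists_rokhlin_partialIsometries ρ hη1 he hee
    (fun g h => (hαe g h).le) (hq 1) (hqe 1).le
  have := E.finiteDimensional_map ρ.π
  obtain ⟨D, hD, hwD⟩ := exists_subalgebra_of_partialIsometries (E.map ρ.π)
    (StarSubalgebra.mem_map.2 ⟨q 1, hqE 1, rfl⟩) hw hw0
  refine ⟨D, hD, fun a ha k => ?_⟩
  have hb (g : G) : ∃ b ∈ E, ‖b - α g⁻¹ a‖ ≤ η := by
    obtain ⟨b, hb, hba⟩ := hES (α g⁻¹ a) (Finset.mem_union_right _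
      (Finset.mem_image.2 ⟨(g, a), by simp [ha], rfl⟩))
    exact ⟨b, hb, (hba.trans_le (min_le_right _ _)).le⟩
  choose b hbE hba using hb
  have haM : ‖a‖ ≤ M := Finset.single_le_sum (f := fun a : A => ‖a‖) (fun _ _ => norm_nonneg _) ha
  have haM' (g : G) : ‖α g⁻¹ a‖ ≤ M := by rwa [StarAlgEquiv.norm_map]
  have hπ (a : A) : ‖ρ.π a‖ ≤ ‖a‖ := NonUnitalStarAlgHom.norm_apply_le ρ.π a
  have hwn (g : G) : ‖w g‖ ≤ 1 := by
    have h1 := IsStarProjection.norm_le _ ((hq 1).map ρ.π)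
    rw [← hw g, CStarRing.norm_star_mul_self] at h1
    nlinarith [norm_nonneg (w g)]
  have hen (g : G) : ‖e g‖ ≤ 1 := IsStarProjection.norm_le _ (he g)
  have hfn (g : G) : ‖ρ.π (e g) * (ρ.u g : ρ.B)‖ ≤ 1 := by
    rw [CStarRing.norm_mul_coe_unitary]
    exact (hπ _).trans (hen g)
  refine ⟨∑ g, w g * ρ.π (b g) * star (w (k⁻¹ * g)), sum_mem fun g _ =>
    hwD _ _ _ (StarSubalgebra.mem_map.2 ⟨b g, hbE g, rfl⟩), ?_⟩
  have htarget : ρ.π a * (ρ.u k : ρ.B) = ∑ g, ρ.π (e g * a) * (ρ.u k : ρ.B) := by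
    rw [← Finset.sum_mul, ← map_sum, ← Finset.sum_mul, hsum, one_mul]
  rw [htarget, ← Finset.sum_sub_distrib]
  refine lt_of_le_of_lt (norm_sum_le_of_le _ (n := fun _ => (9 * M + 6) * η) fun g _ => ?_)
    (by simpa [n] using hηε)
  set h := k⁻¹ * g
  have h1 := norm_triple_sub_le (hwn h) (hfn g) (hwf g) (hwf h)
    (show ‖ρ.π (b g) - ρ.π (α g⁻¹ a)‖ ≤ η by rw [← map_sub]; exact (hπ _).trans (hba g))
    ((hπ _).trans (by linarith [norm_le_norm_add_norm_sub' (b g) (α g⁻¹ a), haM' g, hba g] :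
      ‖b g‖ ≤ M + 1)) ((hπ _).trans (haM' g))
  have h2 : ρ.π (e g) * (ρ.u g : ρ.B) * ρ.π (α g⁻¹ a) * star (ρ.π (e h) * (ρ.u h : ρ.B)) =
      ρ.π (e g * a * α k (e h)) * (ρ.u k : ρ.B) := by
    have h3 : (ρ.u g : ρ.B) * star (ρ.u h : ρ.B) = ρ.u k := by
      rw [show g = k * h by simp [h], map_mul, Submonoid.coe_mul, mul_assoc,
        (Unitary.mem_iff.1 (ρ.u h).2).2, mul_one]
    have h5 : (ρ.u g : ρ.B) * ρ.π (α g⁻¹ a) = ρ.π a * (ρ.u g : ρ.B) := by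
      rw [ρ.u_mul_π, ← StarAlgEquiv.mul_apply, ← map_mul, mul_inv_cancel, map_one,
        StarAlgEquiv.one_apply]
    calc _ = ρ.π (e g) * ((ρ.u g : ρ.B) * ρ.π (α g⁻¹ a)) * (star (ρ.u h : ρ.B) * ρ.π (e h)) := by
          rw [star_mul, ← map_star ρ.π, (he h).isSelfAdjoint.star_eq, mul_assoc (ρ.π (e g))]
      _ = ρ.π (e g) * ρ.π a * ((ρ.u g : ρ.B) * star (ρ.u h : ρ.B) * ρ.π (e h)) := by
          rw [h5]; simp only [mul_assoc]
      _ = _ := by rw [h3, ρ.u_mul_π, map_mul, map_mul, mul_assoc _ _ (ρ.u k : ρ.B)]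
  have h4 : ‖e g * a * α k (e h) - e g * a‖ ≤ (M + 1) * η := by
    have e1 : e g * a * α k (e h) - e g * a =
        e g * a * (α k (e h) - e g) + e g * -(e g * a - a * e g) := by
      have := (he g).isIdempotentElem.eq
      rw [mul_sub, neg_sub, mul_sub, ← mul_assoc (e g) (e g), this, ← mul_assoc]
      abel
    rw [e1]
    refine (norm_add_le _ _).trans ?_
    have h5 : ‖e g * a * (α k (e h) - e g)‖ ≤ 1 * M * η := norm_mul₃_le.trans (by
      have := (hαe k h).le
      rw [show k * h = g by simp [h]] at this
      gcongr
      exact hen g)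
    have h6 : ‖e g * -(e g * a - a * e g)‖ ≤ 1 * η := (norm_mul_le _ _).trans (by
      rw [norm_neg]
      have := (hcomm g a ha).le
      gcongr
      exact hen g)
    linarith
  have h7 : ‖ρ.π (e g * a * α k (e h)) * (ρ.u k : ρ.B) - ρ.π (e g * a) * (ρ.u k : ρ.B)‖ ≤
      (M + 1) * η := by
    rw [← sub_mul, ← map_sub, CStarRing.norm_mul_coe_unitary]
    exact (hπ _).trans h4
  rw [h2] at h1
  have h8 := norm_sub_le_norm_sub_add_norm_sub (w g * ρ.π (b g) * star (w h))
    (ρ.π (e g * a * α k (e h)) * (ρ.u k : ρ.B)) (ρ.π (e g * a) * (ρ.u k : ρ.B))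
  linarith

theorem isLocallyFiniteDimensional (hA : IsLocallyFiniteDimensional A)
    (hα : HasStrictRokhlinProperty α) : IsLocallyFiniteDimensional (CrossedProduct α) := by
  classical
  intro S ε hε
  have hn : (0 : ℝ) < Fintype.card G + 1 := by positivity
  obtain ⟨D, hD, hDS⟩ := exists_finiteDimensional_near hA hα (universalHom α)
    (S.biUnion fun x => Finset.univ.image x.coeff) (div_pos hε hn)
  obtain ⟨F, hF, hDF⟩ := D.exists_unital_ge
  refine ⟨F, hF, fun x hx => ?_⟩
  choose d hdD hd using fun k => hDS (x.coeff k)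
    (Finset.mem_biUnion.2 ⟨x, hx, Finset.mem_image_of_mem _ (Finset.mem_univ k)⟩) k
  refine ⟨∑ k, d k, sum_mem fun k _ => hDF _ (hdD k), ?_⟩
  have h1 : ‖∑ k, d k - (universalHom α).integrate x‖ < ε := by
    rw [CovariantHom.integrate, ← Finset.sum_sub_distrib]
    refine lt_of_le_of_lt (norm_sum_le_of_le _ (n := fun _ => ε / (Fintype.card G + 1))
      fun k _ => (hd k).le) ?_
    rw [Finset.sum_const, Finset.card_univ, nsmul_eq_mul, ← mul_div_assoc, div_lt_iff₀ hn]
    linarith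
  rwa [universalHom_integrate] at h1

end CrossedProduct

theorem mainTheorem8 {A : Type u} [CStarAlgebra A] {G : Type v} [Group G] [Fintype G]
    (α : G →* (A ≃⋆ₐ[ℂ] A)) (hA : IsAFAlgebra A) (hα : HasStrictRokhlinProperty α) :
    IsAFAlgebra (CrossedProduct α) := by
  have := hA.separableSpace
  -- The crossed product is homeomorphic to the finite power `G → A` of a separable space.
  have : TopologicalSpace.SeparableSpace (CrossedProduct α) :=
    (CrossedProduct.coeffCLE α).symm.surjective.denseRange.separableSpace
      (CrossedProduct.coeffCLE α).symm.continuous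
  exact (CrossedProduct.isLocallyFiniteDimensional hA.isLocallyFiniteDimensional hα).isAFAlgebra
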